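/- Let $\mathsf{A}$ be an abelian category with a torsion pair $(\mathcal{T},\mathcal{F})$: $\mathcal{T},\mathcal{F}$ are isomorphism-closed full additive subcategories, $\operatorname{Hom}(T,F)=0$ for $T\in\mathcal{T}$, $F\in\mathcal{F}$, and every object $A$ sits in a short exact sequence $0\to T\to A\to F\to 0$ with $T\in\mathcal{T}$, $F\in\mathcal{F}$. **The category $\mathsf{B}$.** Objects are the two-term complexes $\mathbb{X}=[d\colon X^{-1}\to X^0]$ in $\mathsf{A}$ with $\ker d\in\mathcal{F}$ and $\operatorname{coker} d\in\mathcal{T}$. A morphism $\mathbb{X}\to\mathbb{Y}$ is an isomorphism class of butterflies $(E,\kappa,\iota,\sigma,\rho)$, where $\kappa\colon X^{-1}\to E$, $\iota\colon Y^{-1}\to E$, $\sigma\colon E\to X^0$, $\rho\colon E\to Y^0$ satisfy $\sigma\kappa=d$, $\rho\iota=d$, $\rho\kappa=0$, $\sigma\iota=0$, and $0\to Y^{-1}\xrightarrow{\iota}E\xrightarrow{\sigma}X^0\to0$ is exact; an isomorphism of butterflies is an isomorphism of the middle objects commuting with the four arrows. The composite of $(E,\kappa,\iota,\sigma,\rho)\colon\mathbb{X}\to\mathbb{Y}$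 and $(F,\kappa',\iota',\sigma',\rho')\colon\mathbb{Y}\to\mathbb{Z}$ has middle object $\operatorname{coker}\big((\iota,\kappa')\colon Y^{-1}\to E\times_{Y^0}F\big)$, with arrows induced by $(\kappa,0)$, $(0,\iota')$, $\sigma$ and $\rho'$. A morphism of complexes $f=(f^{-1},f^0)\colon\mathbb{X}\to\mathbb{Y}$ gives the *strict* morphism of $\mathsf{B}$ with middle object $X^0\oplus Y^{-1}$, $\kappa=(d,-f^{-1})$, $\iota=\mathrm{in}_2$, $\sigma=\mathrm{pr}_1$, $\rho=f^0+d$. **The category $\mathsf{Ch}^{st}(\mathsf{B})$.** Objects are the ($\mathbb{Z}$-indexed, cohomological) complexes $\mathbf{X}=({}^n\mathbb{X})_n$ in $\mathsf{B}$. A morphism $\mathbf{X}\to\mathbf{Y}$ is a family of morphisms of two-term complexes $f_n\colon{}^n\mathbb{X}\to{}^n\mathbb{Y}$ in $\mathsf{A}$ whose associated strict morphisms form a morphism of complexes in $\mathsf{B}$. Let $\mathcal{S}_{sis}$ be the class of morphisms that become isomorphisms in $\mathsf{Ch}(\mathsf{B})$, and $\mathcal{S}_{qis}$ the class of morphisms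 that become quasi-isomorphisms in $\mathsf{Ch}(\mathsf{B})$. **The category $\mathsf{Ch}(\mathsf{A},\mathcal{T},\mathcal{F})$.** A decorated complex $(E^\bullet,M^\bullet)$ is a complex $(E^\bullet,\delta)$ in $\mathsf{A}$ with subobjects $M^n\subseteq E^n$, $n\in\mathbb{Z}$, not necessarily respected by $\delta$; a morphism $(E^\bullet,M^\bullet)\to(F^\bullet,N^\bullet)$ is a chain map $f$ with $f(M^n)\subseteq N^n$ for all $n$. Let $H^{-1,n}$ and $H^{0,n}$ be the kernel and the cokernel of the map $M^n\to E^{n+1}/M^{n+1}$ induced by $\delta$. $\mathsf{Ch}(\mathsf{A},\mathcal{T},\mathcal{F})$ is the full subcategory of those $(E^\bullet,M^\bullet)$ with $H^{-1,n}\in\mathcal{F}$ and $H^{0,n}\in\mathcal{T}$ for all $n$. In it, let $\mathcal{S}_{sis}$ be the class of morphisms inducing isomorphisms on all $H^{-1,n}$ and $H^{0,n}$, and $\mathcal{S}_{qis}$ the class of morphisms for which $E^\bullet\to F^\bullet$ is a quasi-isomorphism. **The functor $\operatorname{Tot}$.** Given $\mathbf{X}$, choose a butterfly with middle object $E^n$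 representing the differential ${}^{n-1}\mathbb{X}\to{}^n\mathbb{X}$, and write $\kappa_n,\iota_n,\sigma_n,\rho_n$ for its arrows. Put $M^n=\iota_n({}^nX^{-1})\subseteq E^n$, and let $\delta\colon E^n\to E^{n+1}$ be the unique morphism with $\delta\kappa_n=0$, $\delta\iota_n=\kappa_{n+1}$, $\sigma_{n+1}\delta=\rho_n$ and $\rho_{n+1}\delta=0$. Then $\operatorname{Tot}(\mathbf{X})=(E^\bullet,M^\bullet)$. A morphism $(f_n)_n\colon\mathbf{X}\to\mathbf{Y}$ is sent to the family of the unique morphisms between the middle objects in degree $n$ that are compatible, via $\kappa_n,\iota_n,\sigma_n,\rho_n$, with $f_{n-1}$ and $f_n$. **Theorem.** $\operatorname{Tot}\colon\mathsf{Ch}^{st}(\mathsf{B})\to\mathsf{Ch}(\mathsf{A},\mathcal{T},\mathcal{F})$ is an equivalence of categories. Under it, $\mathcal{S}_{sis}$ and $\mathcal{S}_{qis}$ in $\mathsf{Ch}^{st}(\mathsf{B})$ correspond exactly to $\mathcal{S}_{sis}$ and $\mathcal{S}_{qis}$ in $\mathsf{Ch}(\mathsf{A},\mathcal{T},\mathcal{F})$: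 a morphism $s$ of $\mathsf{Ch}^{st}(\mathsf{B})$ lies in $\mathcal{S}_{sis}$ (resp. $\mathcal{S}_{qis}$) if and only if $\operatorname{Tot}(s)$ does, and the image of each class under $\operatorname{Tot}$, closed under isomorphism of arrows, is the whole corresponding class. -/

import Mathlib

open CategoryTheory CategoryTheory.Limits

attribute [-instance] CategoryTheory.catToReflQuiver

universe v u

noncomputable section

namespace HRSTilt

variable {A : Type u} [Category.{v} A] [Abelian A]

/-- A torsion pair `(𝒯, ℱ)` in an abelian category: two (isomorphism-closed) full subcategories,
given by their object classes, without nonzero morphisms from `𝒯` to `ℱ`, and such that every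
object is an extension of an object of `ℱ` by an object of `𝒯`.  (Both classes then
automatically contain zero and are closed under finite direct sums.) -/
structure TorsionPair (A : Type u) [Category.{v} A] [Abelian A] where
  T : ObjectProperty A
  F : ObjectProperty A
  T_iso : T.IsClosedUnderIsomorphisms
  F_iso : F.IsClosedUnderIsomorphisms
  hom_eq_zero : ∀ {X Y : A}, T X → F Y → ∀ f : X ⟶ Y, f = 0
  exists_shortExact : ∀ X : A, ∃ S : ShortComplex A, S.ShortExact ∧ S.X₂ = X ∧ T S.X₁ ∧ F S.X₃

/-! ### Butterflies -/

/-- A butterfly from the two-term complex `X = [X⁻¹ ⟶ X⁰]` to `Y = [Y⁻¹ ⟶ Y⁰]` (two-term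
complexes are encoded as arrows): both diagonals compose to zero, and
`0 ⟶ Y⁻¹ ⟶ E ⟶ X⁰ ⟶ 0` is short exact. -/
structure Butterfly (X Y : Arrow A) where
  E : A
  κ : X.left ⟶ E
  ι : Y.left ⟶ E
  σ : E ⟶ X.right
  ρ : E ⟶ Y.right
  κ_σ : κ ≫ σ = X.hom
  ι_ρ : ι ≫ ρ = Y.hom
  κ_ρ : κ ≫ ρ = 0
  ι_σ : ι ≫ σ = 0
  exact : (ShortComplex.mk ι σ ι_σ).ShortExact

namespace Butterfly

variable {X Y Z W : Arrow A}

instance (P : Butterfly X Y) : Mono P.ι := P.exact.mono_f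
instance (P : Butterfly X Y) : Epi P.σ := P.exact.epi_g

/-- Two butterflies are isomorphic if there is an isomorphism of their middle objects that
commutes with all four arrows. -/
def Iso (P Q : Butterfly X Y) : Prop :=
  ∃ e : P.E ≅ Q.E, P.κ ≫ e.hom = Q.κ ∧ P.ι ≫ e.hom = Q.ι ∧
    e.hom ≫ Q.σ = P.σ ∧ e.hom ≫ Q.ρ = P.ρ

instance setoid (X Y : Arrow A) : Setoid (Butterfly X Y) where
  r := Iso
  iseqv :=
    { refl := fun P => ⟨CategoryTheory.Iso.refl _, by simp⟩
      symm := by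
        rintro P Q ⟨e, h1, h2, h3, h4⟩
        exact ⟨e.symm, by simp [← h1], by simp [← h2], by simp [← h3], by simp [← h4]⟩
      trans := by
        rintro P Q R ⟨e, h1, h2, h3, h4⟩ ⟨e', h1', h2', h3', h4'⟩
        exact ⟨e ≪≫ e', by simp [← h1', ← h1], by simp [← h2', ← h2], by simp [h3', h3],
          by simp [h4', h4]⟩ }

/-- By the short five lemma, a map commuting with the four arrows is an isomorphism. -/
lemma iso_of_hom {P Q : Butterfly X Y} (f : P.E ⟶ Q.E) (h1 : P.κ ≫ f = Q.κ)
    (h2 : P.ι ≫ f = Q.ι) (h3 : f ≫ Q.σ = P.σ) (h4 : f ≫ Q.ρ = P.ρ) : P ≈ Q := by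
  let φ : ShortComplex.mk P.ι P.σ P.ι_σ ⟶ ShortComplex.mk Q.ι Q.σ Q.ι_σ :=
    { τ₁ := 𝟙 _, τ₂ := f, τ₃ := 𝟙 _, comm₁₂ := by simp [h2], comm₂₃ := by simp [h3] }
  have : IsIso φ.τ₁ := inferInstanceAs (IsIso (𝟙 _))
  have : IsIso φ.τ₃ := inferInstanceAs (IsIso (𝟙 _))
  have : IsIso f := ShortComplex.isIso₂_of_shortExact_of_isIso₁₃ φ P.exact Q.exact
  exact ⟨asIso f, h1, h2, h3, h4⟩

/-- The butterfly of an actual morphism of two-term complexes. -/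
abbrev ofHom (f : X ⟶ Y) : Butterfly X Y where
  E := X.right ⊞ Y.left
  κ := biprod.lift X.hom (-f.left)
  ι := biprod.inr
  σ := biprod.fst
  ρ := biprod.desc f.right Y.hom
  κ_σ := by simp
  ι_ρ := by simp
  κ_ρ := by simp [biprod.lift_desc]
  ι_σ := by simp
  exact := (ShortComplex.Splitting.mk (S := ShortComplex.mk (biprod.inr : Y.left ⟶ X.right ⊞ Y.left)
    biprod.fst (by simp)) biprod.snd biprod.inl (by simp) (by simp)
      (by rw [add_comm]; exact biprod.total)).shortExact

/-- The map `Y⁻¹ ⟶ E ×_{Y⁰} F` with components `ι` and `κ'`. -/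
def compRel (P : Butterfly X Y) (Q : Butterfly Y Z) : Y.left ⟶ pullback P.ρ Q.σ :=
  pullback.lift P.ι Q.κ (by rw [P.ι_ρ, Q.κ_σ])

/-- The middle object of the composition: the quotient by `Y⁻¹` of the fibre product
`E ×_{Y⁰} F`. -/
abbrev compObj (P : Butterfly X Y) (Q : Butterfly Y Z) : A := cokernel (compRel P Q)

section

variable (P : Butterfly X Y) (Q : Butterfly Y Z)

lemma compRel_fst : compRel P Q ≫ pullback.fst _ _ = P.ι := by simp [compRel, pullback.lift_fst]

lemma compRel_snd : compRel P Q ≫ pullback.snd _ _ = Q.κ := by simp [compRel, pullback.lift_snd]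

def compκ : X.left ⟶ pullback P.ρ Q.σ := pullback.lift P.κ 0 (by simp [P.κ_ρ])

def compι : Z.left ⟶ pullback P.ρ Q.σ := pullback.lift 0 Q.ι (by simp [Q.ι_σ])

lemma compκ_fst : compκ P Q ≫ pullback.fst _ _ = P.κ := by simp [compκ, pullback.lift_fst]
lemma compκ_snd : compκ P Q ≫ pullback.snd _ _ = 0 := by simp [compκ, pullback.lift_snd]
lemma compι_fst : compι P Q ≫ pullback.fst _ _ = 0 := by simp [compι, pullback.lift_fst]
lemma compι_snd : compι P Q ≫ pullback.snd _ _ = Q.ι := by simp [compι, pullback.lift_snd]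

def compσ : compObj P Q ⟶ X.right :=
  cokernel.desc _ (pullback.fst _ _ ≫ P.σ) (by rw [reassoc_of% @compRel_fst, P.ι_σ])

def compρ : compObj P Q ⟶ Z.right :=
  cokernel.desc _ (pullback.snd _ _ ≫ Q.ρ) (by rw [reassoc_of% @compRel_snd, Q.κ_ρ])

lemma π_compσ : cokernel.π (compRel P Q) ≫ compσ P Q = pullback.fst _ _ ≫ P.σ := by
  simp [compσ]

lemma π_compρ : cokernel.π (compRel P Q) ≫ compρ P Q = pullback.snd _ _ ≫ Q.ρ := by
  simp [compρ]

lemma exists_of_π_eq_zero {T : A} (x : T ⟶ pullback P.ρ Q.σ)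
    (hx : x ≫ cokernel.π (compRel P Q) = 0) :
    ∃ (T' : A) (π : T' ⟶ T) (_ : Epi π) (b : T' ⟶ Y.left), π ≫ x = b ≫ compRel P Q :=
  (ShortComplex.exact_cokernel (compRel P Q)).exact_up_to_refinements x hx

lemma comp_ι_mono : Mono (compι P Q ≫ cokernel.π (compRel P Q)) := by
  rw [Preadditive.mono_iff_cancel_zero]
  intro T z hz
  obtain ⟨T', π, _, b, hb⟩ := exists_of_π_eq_zero P Q (z ≫ compι P Q) (by simpa using hz)
  have h1 : b = 0 := by
    rw [← cancel_mono P.ι, zero_comp, ← compRel_fst P Q, ← Category.assoc, ← hb]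
    simp [compι_fst]
  rw [← cancel_epi π, ← cancel_mono Q.ι, ← compι_snd P Q]
  have := hb =≫ pullback.snd _ _
  simpa [h1] using this

lemma comp_ι_σ : (compι P Q ≫ cokernel.π (compRel P Q)) ≫ compσ P Q = 0 := by
  rw [Category.assoc, π_compσ, reassoc_of% @compι_fst, zero_comp]

lemma comp_exact :
    (ShortComplex.mk (compι P Q ≫ cokernel.π (compRel P Q)) (compσ P Q)
      (comp_ι_σ P Q)).ShortExact := by
  have := comp_ι_mono P Q
  have : Epi (compσ P Q) := by
    have h : Epi (cokernel.π (compRel P Q) ≫ compσ P Q) := by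
      rw [π_compσ]; exact epi_comp _ _
    exact epi_of_epi (cokernel.π (compRel P Q)) _
  refine ⟨?_⟩
  rw [ShortComplex.exact_iff_exact_up_to_refinements]
  intro T c hc
  dsimp at c hc ⊢
  obtain ⟨T', π, hπ, l, hl⟩ :=
    surjective_up_to_refinements_of_epi (cokernel.π (compRel P Q)) c
  have h0 : (l ≫ pullback.fst _ _) ≫ P.σ = 0 := by
    rw [Category.assoc, ← π_compσ, ← Category.assoc, ← hl, Category.assoc, hc, comp_zero]
  obtain ⟨b, hb⟩ : ∃ b, b ≫ P.ι = l ≫ pullback.fst _ _ :=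
    ⟨P.exact.exact.lift _ h0, P.exact.exact.lift_f _ h0⟩
  have h1 : (l ≫ pullback.snd _ _ - b ≫ Q.κ) ≫ Q.σ = 0 := by
    rw [Preadditive.sub_comp, Category.assoc, ← pullback.condition, ← Category.assoc, ← hb]
    simp [P.ι_ρ, Q.κ_σ]
  obtain ⟨z, hz⟩ : ∃ z, z ≫ Q.ι = l ≫ pullback.snd _ _ - b ≫ Q.κ :=
    ⟨Q.exact.exact.lift _ h1, Q.exact.exact.lift_f _ h1⟩
  refine ⟨T', π, hπ, z, ?_⟩
  have h2 : l = z ≫ compι P Q + b ≫ compRel P Q := by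
    apply pullback.hom_ext
    · simp [compι_fst, compRel_fst, hb]
    · simp [compι_snd, compRel_snd, hz]
  rw [hl, h2]
  simp

/-- The composition of butterflies. -/
def comp : Butterfly X Z where
  E := compObj P Q
  κ := compκ P Q ≫ cokernel.π _
  ι := compι P Q ≫ cokernel.π _
  σ := compσ P Q
  ρ := compρ P Q
  κ_σ := by rw [Category.assoc, π_compσ, reassoc_of% @compκ_fst, P.κ_σ]
  ι_ρ := by rw [Category.assoc, π_compρ, reassoc_of% @compι_snd, Q.ι_ρ]
  κ_ρ := by rw [Category.assoc, π_compρ, reassoc_of% @compκ_snd, zero_comp]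
  ι_σ := comp_ι_σ P Q
  exact := comp_exact P Q

/-- The quotient map from the fibre product to the middle object of the composition. -/
def compπ : pullback P.ρ Q.σ ⟶ (comp P Q).E := cokernel.π (compRel P Q)

instance : Epi (compπ P Q) := inferInstanceAs (Epi (cokernel.π _))

/-- A map exhibiting `R` as the composition of `P` and `Q`. -/
structure IsComp (R : Butterfly X Z) (r : pullback P.ρ Q.σ ⟶ R.E) : Prop where
  rel : compRel P Q ≫ r = 0
  κ : compκ P Q ≫ r = R.κ
  ι : compι P Q ≫ r = R.ι
  σ : r ≫ R.σ = pullback.fst _ _ ≫ P.σ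
  ρ : r ≫ R.ρ = pullback.snd _ _ ≫ Q.ρ

lemma isComp_comp : IsComp P Q (comp P Q) (compπ P Q) :=
  ⟨cokernel.condition _, rfl, rfl, π_compσ P Q, π_compρ P Q⟩

variable {P Q} in
lemma IsComp.equiv {R : Butterfly X Z} {r : pullback P.ρ Q.σ ⟶ R.E} (h : IsComp P Q R r) :
    comp P Q ≈ R := by
  have hc := isComp_comp P Q
  obtain ⟨f, hf⟩ : ∃ f : (comp P Q).E ⟶ R.E, compπ P Q ≫ f = r :=
    ⟨cokernel.desc _ r h.rel, cokernel.π_desc _ _ _⟩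
  refine iso_of_hom f ?_ ?_ ?_ ?_
  · rw [← hc.κ, Category.assoc, hf, h.κ]
  · rw [← hc.ι, Category.assoc, hf, h.ι]
  · rw [← cancel_epi (compπ P Q), reassoc_of% hf, h.σ, hc.σ]
  · rw [← cancel_epi (compπ P Q), reassoc_of% hf, h.ρ, hc.ρ]

end

lemma comp_congr {P P' : Butterfly X Y} {Q Q' : Butterfly Y Z} (h : P ≈ P') (h' : Q ≈ Q') :
    comp P Q ≈ comp P' Q' := by
  obtain ⟨e, h1, h2, h3, h4⟩ := h
  obtain ⟨e', h1', h2', h3', h4'⟩ := h'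
  obtain ⟨m, hm1, hm2⟩ : ∃ m : pullback P.ρ Q.σ ⟶ pullback P'.ρ Q'.σ,
      m ≫ pullback.fst _ _ = pullback.fst _ _ ≫ e.hom ∧
      m ≫ pullback.snd _ _ = pullback.snd _ _ ≫ e'.hom :=
    ⟨pullback.lift (pullback.fst _ _ ≫ e.hom) (pullback.snd _ _ ≫ e'.hom)
      (by rw [Category.assoc, h4, Category.assoc, h3', pullback.condition]),
      pullback.lift_fst _ _ _, pullback.lift_snd _ _ _⟩
  have hc := isComp_comp P' Q'
  refine IsComp.equiv (r := m ≫ compπ P' Q') ⟨?_, ?_, ?_, ?_, ?_⟩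
  · have : compRel P Q ≫ m = compRel P' Q' := by
      apply pullback.hom_ext
      · rw [Category.assoc, hm1, reassoc_of% @compRel_fst, compRel_fst, h2]
      · rw [Category.assoc, hm2, reassoc_of% @compRel_snd, compRel_snd, h1']
    rw [reassoc_of% this, hc.rel]
  · have : compκ P Q ≫ m = compκ P' Q' := by
      apply pullback.hom_ext
      · rw [Category.assoc, hm1, reassoc_of% @compκ_fst, compκ_fst, h1]
      · rw [Category.assoc, hm2, reassoc_of% @compκ_snd, compκ_snd, zero_comp]
    rw [reassoc_of% this, hc.κ]
  · have : compι P Q ≫ m = compι P' Q' := by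
      apply pullback.hom_ext
      · rw [Category.assoc, hm1, reassoc_of% @compι_fst, compι_fst, zero_comp]
      · rw [Category.assoc, hm2, reassoc_of% @compι_snd, compι_snd, h2']
    rw [reassoc_of% this, hc.ι]
  · rw [Category.assoc, hc.σ, reassoc_of% hm1, h3]
  · rw [Category.assoc, hc.ρ, reassoc_of% hm2, h4']

/-- Postcomposition with a strict morphism `g` only requires a map `E ⟶ R` that is
compatible with `g`. -/
lemma comp_ofHom_equiv {P : Butterfly X Y} {g : Y ⟶ Z} {R : Butterfly X Z} (φ : P.E ⟶ R.E)
    (hκ : P.κ ≫ φ = R.κ) (hι : P.ι ≫ φ = g.left ≫ R.ι) (hσ : φ ≫ R.σ = P.σ)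
    (hρ : φ ≫ R.ρ = P.ρ ≫ g.right) : comp P (ofHom g) ≈ R := by
  refine IsComp.equiv (r := pullback.fst P.ρ (ofHom g).σ ≫ φ +
    pullback.snd P.ρ (ofHom g).σ ≫ biprod.snd ≫ R.ι) ⟨?_, ?_, ?_, ?_, ?_⟩
  · rw [Preadditive.comp_add, reassoc_of% @compRel_fst, reassoc_of% @compRel_snd]
    simp [hι]
  · rw [Preadditive.comp_add, reassoc_of% @compκ_fst, reassoc_of% @compκ_snd]
    simp [hκ]
  · rw [Preadditive.comp_add, reassoc_of% @compι_fst, reassoc_of% @compι_snd]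
    simp
  · simp [R.ι_σ, hσ]
  · have h : pullback.fst P.ρ (ofHom g).σ ≫ P.ρ = pullback.snd _ _ ≫ biprod.fst :=
      pullback.condition
    rw [Preadditive.add_comp, Category.assoc, hρ, reassoc_of% h]
    simp only [Category.assoc, R.ι_ρ, ← Preadditive.comp_add]
    congr 1
    apply biprod.hom_ext' <;> simp

/-- Precomposition with a strict morphism `f` only requires a map `R ⟶ F` that is
compatible with `f`. -/
lemma ofHom_comp_equiv {f : X ⟶ Y} {Q : Butterfly Y Z} {R : Butterfly X Z} (φ : R.E ⟶ Q.E)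
    (hκ : R.κ ≫ φ = f.left ≫ Q.κ) (hι : R.ι ≫ φ = Q.ι) (hσ : φ ≫ Q.σ = R.σ ≫ f.right)
    (hρ : φ ≫ Q.ρ = R.ρ) : comp (ofHom f) Q ≈ R := by
  have hc := isComp_comp (ofHom f) Q
  obtain ⟨m, hm1, hm2⟩ : ∃ m : R.E ⟶ pullback (ofHom f).ρ Q.σ,
      m ≫ pullback.fst _ _ = biprod.lift R.σ 0 ∧ m ≫ pullback.snd _ _ = φ :=
    ⟨pullback.lift (biprod.lift R.σ 0) φ (by simp [hσ]), pullback.lift_fst _ _ _,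
      pullback.lift_snd _ _ _⟩
  symm
  refine iso_of_hom (m ≫ compπ (ofHom f) Q) ?_ ?_ ?_ ?_
  · have : R.κ ≫ m = compκ (ofHom f) Q + f.left ≫ compRel (ofHom f) Q := by
      apply pullback.hom_ext
      · rw [Category.assoc, hm1, Preadditive.add_comp, compκ_fst, Category.assoc, compRel_fst]
        apply biprod.hom_ext <;> simp [R.κ_σ]
      · rw [Category.assoc, hm2, Preadditive.add_comp, compκ_snd, Category.assoc, compRel_snd,
          hκ, zero_add]
    rw [reassoc_of% this, Preadditive.add_comp, Category.assoc, hc.rel, hc.κ, comp_zero, add_zero]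
  · have : R.ι ≫ m = compι (ofHom f) Q := by
      apply pullback.hom_ext
      · rw [Category.assoc, hm1, compι_fst]
        apply biprod.hom_ext <;> simp [R.ι_σ]
      · rw [Category.assoc, hm2, compι_snd, hι]
    rw [reassoc_of% this, hc.ι]
  · rw [Category.assoc, hc.σ, reassoc_of% hm1]
    simp
  · rw [Category.assoc, hc.ρ, reassoc_of% hm2, hρ]

lemma comp_id (P : Butterfly X Y) : comp P (ofHom (𝟙 Y)) ≈ P :=
  comp_ofHom_equiv (𝟙 _) (by simp) (by simp) (by simp) (by simp)

lemma id_comp (P : Butterfly X Y) : comp (ofHom (𝟙 X)) P ≈ P :=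
  ofHom_comp_equiv (𝟙 _) (by simp) (by simp) (by simp) (by simp)

lemma ofHom_comp_ofHom (f : X ⟶ Y) (g : Y ⟶ Z) :
    comp (ofHom f) (ofHom g) ≈ ofHom (f ≫ g) := by
  refine comp_ofHom_equiv (biprod.map (𝟙 _) g.left) ?_ ?_ ?_ ?_
  · apply biprod.hom_ext <;> simp
  · simp
  · simp
  · apply biprod.hom_ext' <;> simp

/-- The zero morphism of two-term complexes. -/
def zeroHom (X Y : Arrow A) : X ⟶ Y := Arrow.homMk 0 0 (by simp)

lemma comp_zero' (P : Butterfly X Y) : comp P (ofHom (zeroHom Y Z)) ≈ ofHom (zeroHom X Z) := by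
  refine comp_ofHom_equiv (biprod.lift P.σ 0) ?_ ?_ ?_ ?_
  · apply biprod.hom_ext <;> simp [zeroHom, P.κ_σ]
  · apply biprod.hom_ext <;> simp [zeroHom, P.ι_σ]
  · simp
  · simp [zeroHom]

lemma zero_comp' (P : Butterfly Y Z) : comp (ofHom (zeroHom X Y)) P ≈ ofHom (zeroHom X Z) := by
  refine ofHom_comp_equiv (biprod.snd ≫ P.ι) ?_ ?_ ?_ ?_
  · simp [zeroHom]
  · simp
  · simp [zeroHom, P.ι_σ]
  · apply biprod.hom_ext' <;> simp [zeroHom, P.ι_ρ]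

lemma assoc_aux {P : Butterfly X Y} {Q : Butterfly Y Z} {R : Butterfly Z W}
    {C : Butterfly X Z} {p : pullback P.ρ Q.σ ⟶ C.E} (hC : IsComp P Q C p) [Epi p]
    (hp : ∀ {T : A} (x : T ⟶ pullback P.ρ Q.σ), x ≫ p = 0 →
      ∃ (T' : A) (π : T' ⟶ T) (_ : Epi π) (b : T' ⟶ Y.left), π ≫ x = b ≫ compRel P Q)
    {D : Butterfly Y W} {p' : pullback Q.ρ R.σ ⟶ D.E} (hD : IsComp Q R D p')
    {H : Butterfly X W} {p'' : pullback P.ρ D.σ ⟶ H.E} (hH : IsComp P D H p'') :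
    comp C R ≈ H := by
  -- `L` is the triple fibre product, with projections `a`, `b`, `c`
  obtain ⟨L, q, l, hq, _, hL⟩ : ∃ (L : A) (q : L ⟶ pullback C.ρ R.σ) (l : L ⟶ pullback P.ρ Q.σ),
      q ≫ pullback.fst _ _ = l ≫ p ∧ Epi q ∧ ∀ {T : A} (u : T ⟶ pullback P.ρ Q.σ)
        (w : T ⟶ pullback C.ρ R.σ), u ≫ p = w ≫ pullback.fst _ _ →
        ∃ x : T ⟶ L, x ≫ l = u ∧ x ≫ q = w :=
    ⟨pullback p (pullback.fst C.ρ R.σ), pullback.snd _ _, pullback.fst _ _,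
      pullback.condition.symm, inferInstance,
      fun u w h => ⟨pullback.lift u w h, pullback.lift_fst _ _ _, pullback.lift_snd _ _ _⟩⟩
  obtain ⟨a, ha⟩ : ∃ a, l ≫ pullback.fst _ _ = a := ⟨_, rfl⟩
  obtain ⟨b, hb⟩ : ∃ b, l ≫ pullback.snd _ _ = b := ⟨_, rfl⟩
  obtain ⟨c, hc⟩ : ∃ c, q ≫ pullback.snd _ _ = c := ⟨_, rfl⟩
  have hab : a ≫ P.ρ = b ≫ Q.σ := by
    rw [← ha, ← hb, Category.assoc, Category.assoc, pullback.condition]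
  have hbc : b ≫ Q.ρ = c ≫ R.σ := by
    rw [← hb, ← hc, Category.assoc, Category.assoc, ← hC.ρ, ← reassoc_of% hq, pullback.condition]
  obtain ⟨bc, hbc1, hbc2⟩ : ∃ bc : L ⟶ pullback Q.ρ R.σ,
      bc ≫ pullback.fst _ _ = b ∧ bc ≫ pullback.snd _ _ = c :=
    ⟨pullback.lift b c hbc, pullback.lift_fst _ _ _, pullback.lift_snd _ _ _⟩
  obtain ⟨abc, habc1, habc2⟩ : ∃ abc : L ⟶ pullback P.ρ D.σ,
      abc ≫ pullback.fst _ _ = a ∧ abc ≫ pullback.snd _ _ = bc ≫ p' :=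
    ⟨pullback.lift a (bc ≫ p') (by rw [Category.assoc, hD.σ, hab, reassoc_of% hbc1]),
      pullback.lift_fst _ _ _, pullback.lift_snd _ _ _⟩
  have key : ∀ {T : A} (x : T ⟶ L) (y : T ⟶ Y.left) (z : T ⟶ Z.left) (x' : T ⟶ X.left)
      (w : T ⟶ W.left),
      x ≫ a = y ≫ P.ι + x' ≫ P.κ → x ≫ b = y ≫ Q.κ + z ≫ Q.ι → x ≫ c = z ≫ R.κ + w ≫ R.ι →
      x ≫ abc ≫ p'' = x' ≫ H.κ + w ≫ H.ι := by
    intro T x y z x' w ha hb hc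
    have e1 : x ≫ bc = y ≫ compκ Q R + z ≫ compRel Q R + w ≫ compι Q R := by
      apply pullback.hom_ext
      · simp [hbc1, hb, compκ_fst, compRel_fst, compι_fst]
      · simp [hbc2, hc, compκ_snd, compRel_snd, compι_snd]
    have e2 : x ≫ bc ≫ p' = y ≫ D.κ + w ≫ D.ι := by
      rw [reassoc_of% e1]
      simp [hD.κ, hD.ι, hD.rel]
    have e3 : x ≫ abc = x' ≫ compκ P D + y ≫ compRel P D + w ≫ compι P D := by
      apply pullback.hom_ext
      · rw [Category.assoc, habc1, ha]
        simp [compκ_fst, compRel_fst, compι_fst, add_comm]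
      · rw [Category.assoc, habc2, e2]
        simp [compκ_snd, compRel_snd, compι_snd]
    rw [reassoc_of% e3]
    simp [hH.κ, hH.ι, hH.rel]
  have hker : kernel.ι q ≫ abc ≫ p'' = 0 := by
    obtain ⟨T', π, _, y, hy⟩ := hp (kernel.ι q ≫ l)
      (by rw [Category.assoc, ← hq, kernel.condition_assoc, zero_comp])
    rw [← cancel_epi π, comp_zero]
    have := key (π ≫ kernel.ι q) y 0 0 0 ?_ ?_ ?_
    · simpa using this
    · have := hy =≫ pullback.fst _ _
      simpa [compRel_fst, ha] using this
    · have := hy =≫ pullback.snd _ _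
      simpa [compRel_snd, hb] using this
    · simp [← hc]
  obtain ⟨r, hr⟩ : ∃ r, q ≫ r = abc ≫ p'' :=
    ⟨Abelian.epiDesc q _ hker, Abelian.comp_epiDesc q _ hker⟩
  refine IsComp.equiv (r := r) ⟨?_, ?_, ?_, ?_, ?_⟩
  · obtain ⟨x, hx, hx'⟩ := hL (compι P Q) (compRel C R) (by rw [compRel_fst, hC.ι])
    rw [← hx', Category.assoc, hr]
    have := key x 0 (𝟙 _) 0 0 (by rw [← ha, reassoc_of% hx, compι_fst]; simp)
      (by rw [← hb, reassoc_of% hx, compι_snd]; simp)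
      (by rw [← hc, reassoc_of% hx', compRel_snd]; simp)
    simpa using this
  · obtain ⟨x, hx, hx'⟩ := hL (compκ P Q) (compκ C R) (by rw [compκ_fst, hC.κ])
    rw [← hx', Category.assoc, hr]
    have := key x 0 0 (𝟙 _) 0 (by rw [← ha, reassoc_of% hx, compκ_fst]; simp)
      (by rw [← hb, reassoc_of% hx, compκ_snd]; simp)
      (by rw [← hc, reassoc_of% hx', compκ_snd]; simp)
    simpa using this
  · obtain ⟨x, hx, hx'⟩ := hL 0 (compι C R) (by rw [compι_fst, zero_comp])
    rw [← hx', Category.assoc, hr]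
    have := key x 0 0 0 (𝟙 _) (by rw [← ha, reassoc_of% hx]; simp)
      (by rw [← hb, reassoc_of% hx]; simp)
      (by rw [← hc, reassoc_of% hx', compι_snd]; simp)
    simpa using this
  · rw [← cancel_epi q, reassoc_of% hr, hH.σ, reassoc_of% habc1, reassoc_of% hq, hC.σ,
      reassoc_of% ha]
  · rw [← cancel_epi q, reassoc_of% hr, hH.ρ, reassoc_of% habc2, hD.ρ, reassoc_of% hbc2,
      reassoc_of% hc]

lemma assoc (P : Butterfly X Y) (Q : Butterfly Y Z) (R : Butterfly Z W) :
    comp (comp P Q) R ≈ comp P (comp Q R) :=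
  assoc_aux (isComp_comp P Q) (exists_of_π_eq_zero P Q) (isComp_comp Q R)
    (isComp_comp P (comp Q R))

/-- If the composition of two butterflies is the zero morphism, there is a link between them. -/
lemma exists_link {P : Butterfly X Y} {Q : Butterfly Y Z}
    (h : comp P Q ≈ ofHom (zeroHom X Z)) :
    ∃ δ : P.E ⟶ Q.E, P.κ ≫ δ = 0 ∧ P.ι ≫ δ = Q.κ ∧ δ ≫ Q.σ = P.ρ ∧ δ ≫ Q.ρ = 0 := by
  have hc := isComp_comp P Q
  obtain ⟨e, h1, h2, h3, h4⟩ := h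
  obtain ⟨s, hs⟩ : ∃ s, compπ P Q ≫ e.hom ≫ biprod.snd = s := ⟨_, rfl⟩
  have sκ : compκ P Q ≫ s = 0 := by
    rw [← hs, reassoc_of% hc.κ, reassoc_of% h1]; simp [zeroHom]
  have sι : compι P Q ≫ s = 𝟙 _ := by
    rw [← hs, reassoc_of% hc.ι, reassoc_of% h2]; simp
  have srel : compRel P Q ≫ s = 0 := by
    rw [← hs, reassoc_of% hc.rel, zero_comp]
  have sρ : s ≫ Z.hom = pullback.snd _ _ ≫ Q.ρ := by
    rw [← hc.ρ, ← h4, ← hs, Category.assoc, Category.assoc]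
    congr 2
    apply biprod.hom_ext' <;> simp [zeroHom]
  obtain ⟨g, hg⟩ : ∃ g, pullback.snd P.ρ Q.σ - s ≫ Q.ι = g := ⟨_, rfl⟩
  have hker : kernel.ι (pullback.fst P.ρ Q.σ) ≫ g = 0 := by
    have h0 : (kernel.ι (pullback.fst P.ρ Q.σ) ≫ pullback.snd _ _) ≫ Q.σ = 0 := by
      rw [Category.assoc, ← pullback.condition, kernel.condition_assoc, zero_comp]
    obtain ⟨z, hz⟩ : ∃ z, z ≫ Q.ι = kernel.ι (pullback.fst P.ρ Q.σ) ≫ pullback.snd _ _ :=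
      ⟨Q.exact.exact.lift _ h0, Q.exact.exact.lift_f _ h0⟩
    have : kernel.ι (pullback.fst P.ρ Q.σ) = z ≫ compι P Q := by
      apply pullback.hom_ext
      · simp [compι_fst]
      · simp [compι_snd, hz]
    rw [this, ← hg, Category.assoc, Preadditive.comp_sub, compι_snd, reassoc_of% sι, sub_self,
      comp_zero]
  obtain ⟨δ, hδ⟩ : ∃ δ, pullback.fst P.ρ Q.σ ≫ δ = g :=
    ⟨Abelian.epiDesc _ _ hker, Abelian.comp_epiDesc _ _ hker⟩
  refine ⟨δ, ?_, ?_, ?_, ?_⟩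
  · rw [← compκ_fst P Q, Category.assoc, hδ, ← hg, Preadditive.comp_sub, compκ_snd,
      reassoc_of% sκ, zero_comp, sub_zero]
  · rw [← compRel_fst P Q, Category.assoc, hδ, ← hg, Preadditive.comp_sub, compRel_snd,
      reassoc_of% srel, zero_comp, sub_zero]
  · rw [← cancel_epi (pullback.fst P.ρ Q.σ), reassoc_of% hδ, ← hg, Preadditive.sub_comp,
      Category.assoc, Q.ι_σ, comp_zero, sub_zero, pullback.condition]
  · rw [← cancel_epi (pullback.fst P.ρ Q.σ), reassoc_of% hδ, ← hg, Preadditive.sub_comp,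
      Category.assoc, Q.ι_ρ, sρ, sub_self, comp_zero]

/-- A commutative square with two strict sides induces a map of middle objects. -/
lemma exists_map {P : Butterfly X Y} {g : Y ⟶ Z} {f : X ⟶ W} {Q : Butterfly W Z}
    (h : comp P (ofHom g) ≈ comp (ofHom f) Q) :
    ∃ φ : P.E ⟶ Q.E, P.κ ≫ φ = f.left ≫ Q.κ ∧ P.ι ≫ φ = g.left ≫ Q.ι ∧
      φ ≫ Q.σ = P.σ ≫ f.right ∧ φ ≫ Q.ρ = P.ρ ≫ g.right := by
  have hc := isComp_comp P (ofHom g)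
  have hc' := isComp_comp (ofHom f) Q
  obtain ⟨e, h1, h2, h3, h4⟩ := h
  obtain ⟨m, hm1, hm2⟩ : ∃ m : P.E ⟶ pullback P.ρ (ofHom g).σ,
      m ≫ pullback.fst _ _ = 𝟙 _ ∧ m ≫ pullback.snd _ _ = biprod.lift P.ρ 0 :=
    ⟨pullback.lift (𝟙 _) (biprod.lift P.ρ 0) (by simp), pullback.lift_fst _ _ _,
      pullback.lift_snd _ _ _⟩
  obtain ⟨n, hn⟩ : ∃ n : (comp (ofHom f) Q).E ⟶ Q.E, compπ (ofHom f) Q ≫ n =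
      pullback.snd (ofHom f).ρ Q.σ - pullback.fst (ofHom f).ρ Q.σ ≫ biprod.snd ≫ Q.κ := by
    refine ⟨cokernel.desc _ _ ?_, cokernel.π_desc _ _ _⟩
    rw [Preadditive.comp_sub, compRel_snd, reassoc_of% @compRel_fst]
    simp
  refine ⟨m ≫ compπ P (ofHom g) ≫ e.hom ≫ n, ?_, ?_, ?_, ?_⟩
  · have : P.κ ≫ m = compκ P (ofHom g) := by
      apply pullback.hom_ext
      · rw [Category.assoc, hm1, compκ_fst, Category.comp_id]
      · rw [Category.assoc, hm2, compκ_snd]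
        apply biprod.hom_ext <;> simp [P.κ_ρ]
    rw [reassoc_of% this, reassoc_of% hc.κ, reassoc_of% h1, ← hc'.κ, Category.assoc, hn,
      Preadditive.comp_sub, compκ_snd, reassoc_of% @compκ_fst]
    simp
  · have : P.ι ≫ m = compRel P (ofHom g) + g.left ≫ compι P (ofHom g) := by
      apply pullback.hom_ext
      · rw [Category.assoc, hm1, Preadditive.add_comp, Category.assoc, compRel_fst, compι_fst]
        simp
      · rw [Category.assoc, hm2, Preadditive.add_comp, Category.assoc, compRel_snd, compι_snd]
        apply biprod.hom_ext <;> simp [P.ι_ρ]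
    rw [reassoc_of% this, Preadditive.add_comp, reassoc_of% hc.rel, zero_comp, zero_add,
      Category.assoc, reassoc_of% hc.ι, reassoc_of% h2, ← hc'.ι, Category.assoc, hn,
      Preadditive.comp_sub, compι_snd, reassoc_of% @compι_fst]
    simp
  · have hnσ : n ≫ Q.σ = (comp (ofHom f) Q).σ ≫ f.right := by
      rw [← cancel_epi (compπ (ofHom f) Q), reassoc_of% hn, reassoc_of% hc'.σ,
        Preadditive.sub_comp, ← pullback.condition]
      simp only [Category.assoc, Q.κ_σ, ← Preadditive.comp_sub]
      congr 1
      apply biprod.hom_ext' <;> simp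
    simp only [Category.assoc]
    rw [hnσ, reassoc_of% h3, reassoc_of% hc.σ, reassoc_of% hm1]
  · have hnρ : n ≫ Q.ρ = (comp (ofHom f) Q).ρ := by
      rw [← cancel_epi (compπ (ofHom f) Q), reassoc_of% hn, hc'.ρ, Preadditive.sub_comp]
      simp [Q.κ_ρ]
    simp only [Category.assoc]
    rw [hnρ, h4, hc.ρ, reassoc_of% hm2]
    simp

/-- The vanishing principle behind the uniqueness of links and of induced maps. -/
lemma eq_zero_of_torsion (t : TorsionPair A) {P : Butterfly X Y} {Q : Butterfly Z W}
    (hX : t.T (cokernel X.hom)) (hW : t.F (kernel W.hom)) (h : P.E ⟶ Q.E)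
    (h1 : P.κ ≫ h = 0) (h2 : P.ι ≫ h = 0) (h3 : h ≫ Q.σ = 0) (h4 : h ≫ Q.ρ = 0) : h = 0 := by
  obtain ⟨a, ha⟩ : ∃ a, P.σ ≫ a = h := ⟨P.exact.exact.desc h h2, P.exact.exact.g_desc h h2⟩
  have ha' : X.hom ≫ a = 0 := by rw [← P.κ_σ, Category.assoc, ha, h1]
  obtain ⟨b, hb⟩ : ∃ b, cokernel.π X.hom ≫ b = a := ⟨cokernel.desc _ a ha', cokernel.π_desc _ _ _⟩
  have hb' : b ≫ Q.σ = 0 := by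
    rw [← cancel_epi (cokernel.π X.hom), ← cancel_epi P.σ, reassoc_of% hb, reassoc_of% ha, h3]
    simp
  obtain ⟨c, hc⟩ : ∃ c, c ≫ Q.ι = b := ⟨Q.exact.exact.lift b hb', Q.exact.exact.lift_f b hb'⟩
  have hc' : c ≫ W.hom = 0 := by
    rw [← Q.ι_ρ, reassoc_of% hc, ← cancel_epi (cokernel.π X.hom), ← cancel_epi P.σ,
      reassoc_of% hb, reassoc_of% ha, h4]
    simp
  have hc0 : c = 0 := by
    rw [← kernel.lift_ι W.hom c hc', t.hom_eq_zero hX hW (kernel.lift W.hom c hc'), zero_comp]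
  rw [← ha, ← hb, ← hc, hc0]
  simp

end Butterfly

/-! ### The tilted category -/

/-- Objects of the tilted category `B`: two-term complexes `[X⁻¹ ⟶ X⁰]` whose kernel is in `ℱ`
and whose cokernel is in `𝒯`. -/
structure Tilt (t : TorsionPair A) where
  arrow : Arrow A
  ker_mem : t.F (kernel arrow.hom)
  coker_mem : t.T (cokernel arrow.hom)

namespace Tilt

variable {t : TorsionPair A}

/-- The tilted category `B`: morphisms are isomorphism classes of butterflies. -/
instance : Category.{max u v} (Tilt t) where
  Hom X Y := Quotient (Butterfly.setoid X.arrow Y.arrow)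
  id X := ⟦Butterfly.ofHom (𝟙 X.arrow)⟧
  comp := Quotient.map₂ Butterfly.comp fun _ _ h _ _ h' => Butterfly.comp_congr h h'
  id_comp := by
    rintro X Y ⟨P⟩
    exact Quotient.sound (Butterfly.id_comp P)
  comp_id := by
    rintro X Y ⟨P⟩
    exact Quotient.sound (Butterfly.comp_id P)
  assoc := by
    rintro X Y Z W ⟨P⟩ ⟨Q⟩ ⟨R⟩
    exact Quotient.sound (Butterfly.assoc P Q R)

/-- The morphism of `B` represented by a butterfly. -/
def ofB {X Y : Tilt t} (P : Butterfly X.arrow Y.arrow) : X ⟶ Y := Quotient.mk _ P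

/-- A representative of a morphism of `B`. -/
def out {X Y : Tilt t} (f : X ⟶ Y) : Butterfly X.arrow Y.arrow := Quotient.out f

lemma ofB_out {X Y : Tilt t} (f : X ⟶ Y) : ofB (out f) = f := Quotient.out_eq f

lemma ofB_comp {X Y Z : Tilt t} (P : Butterfly X.arrow Y.arrow) (Q : Butterfly Y.arrow Z.arrow) :
    ofB P ≫ ofB Q = ofB (P.comp Q) := rfl

lemma ofB_eq_iff {X Y : Tilt t} (P Q : Butterfly X.arrow Y.arrow) : ofB P = ofB Q ↔ P ≈ Q :=
  Quotient.eq

/-- The strict morphism of `B` given by a morphism of two-term complexes. -/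
def strict {X Y : Tilt t} (f : X.arrow ⟶ Y.arrow) : X ⟶ Y := ofB (Butterfly.ofHom f)

lemma strict_id (X : Tilt t) : strict (𝟙 X.arrow) = 𝟙 X := rfl

lemma strict_comp {X Y Z : Tilt t} (f : X.arrow ⟶ Y.arrow) (g : Y.arrow ⟶ Z.arrow) :
    strict (f ≫ g) = strict f ≫ strict g :=
  (Quotient.sound (Butterfly.ofHom_comp_ofHom f g)).symm

instance : HasZeroMorphisms (Tilt t) where
  zero X Y := ⟨strict (Butterfly.zeroHom X.arrow Y.arrow)⟩
  comp_zero := by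
    rintro X Y ⟨P⟩ Z
    exact Quotient.sound (Butterfly.comp_zero' P)
  zero_comp := by
    rintro X Y Z ⟨P⟩
    exact Quotient.sound (Butterfly.zero_comp' P)

lemma zero_def (X Y : Tilt t) :
    (0 : X ⟶ Y) = ofB (Butterfly.ofHom (Butterfly.zeroHom X.arrow Y.arrow)) := rfl

end Tilt

/-! ### Complexes in `B` and strict morphisms -/

/-- Objects of `Ch^st(B)`: cochain complexes in `B`. -/
structure ChSt (t : TorsionPair A) where
  cx : CochainComplex (Tilt t) ℤ

namespace ChSt

variable {t : TorsionPair A}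

/-- Morphisms of `Ch^st(B)`: a family of morphisms of two-term complexes such that the
associated strict morphisms of `B` form a morphism of complexes in `B`. -/
@[ext]
structure Hom (X Y : ChSt t) where
  f : ∀ n : ℤ, (X.cx.X n).arrow ⟶ (Y.cx.X n).arrow
  comm : ∀ i j : ℤ, Tilt.strict (f i) ≫ Y.cx.d i j = X.cx.d i j ≫ Tilt.strict (f j)

instance : Category (ChSt t) where
  Hom := Hom
  id X := ⟨fun _ => 𝟙 _, fun i j => by
    rw [Tilt.strict_id, Tilt.strict_id, Category.id_comp, Category.comp_id]⟩
  comp φ ψ := ⟨fun n => φ.f n ≫ ψ.f n, fun i j => by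
    rw [Tilt.strict_comp, Tilt.strict_comp, Category.assoc, ψ.comm, ← Category.assoc, φ.comm,
      Category.assoc]⟩
  id_comp _ := Hom.ext (by funext n; exact Category.id_comp _)
  comp_id _ := Hom.ext (by funext n; exact Category.comp_id _)
  assoc _ _ _ := Hom.ext (by funext n; exact Category.assoc _ _ _)

/-- The functor `Ch^st(B) ⥤ Ch(B)`. -/
def toCh (t : TorsionPair A) : ChSt t ⥤ CochainComplex (Tilt t) ℤ where
  obj X := X.cx
  map φ := { f := fun n => Tilt.strict (φ.f n), comm' := fun i j _ => φ.comm i j }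
  map_id X := by ext n; exact Tilt.strict_id _
  map_comp φ ψ := by ext n; exact Tilt.strict_comp (ChSt.Hom.f φ n) (ChSt.Hom.f ψ n)

/-- Strict morphisms of complexes that become isomorphisms in `Ch(B)`. -/
def sis (t : TorsionPair A) : MorphismProperty (ChSt t) := fun _ _ φ => IsIso ((toCh t).map φ)

/-- Strict morphisms of complexes that are quasi-isomorphisms in `Ch(B)`. The existence of the
cohomology objects in `B` is not presupposed but part of the condition. -/
def qis (t : TorsionPair A) : MorphismProperty (ChSt t) := fun X Y φ =>
  ∀ n : ℤ, ∃ (_ : ((toCh t).obj X).HasHomology n) (_ : ((toCh t).obj Y).HasHomology n),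
    QuasiIsoAt ((toCh t).map φ) n

end ChSt

/-! ### Decorated complexes -/

variable (A) in
/-- A decorated complex: a complex `E` with a subobject `M n` of each `E n`, not necessarily
respected by the differential. -/
structure Dec where
  cx : CochainComplex A ℤ
  M : ∀ n : ℤ, Subobject (cx.X n)

namespace Dec

/-- Morphisms of decorated complexes: chain maps `φ` with `φ (M n) ⊆ N n`. -/
@[ext]
structure Hom (E F : Dec A) where
  φ : E.cx ⟶ F.cx
  factors : ∀ n : ℤ, (F.M n).Factors ((E.M n).arrow ≫ φ.f n)

instance : Category (Dec A) where
  Hom := Hom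
  id E := ⟨𝟙 _, fun n => by
    rw [HomologicalComplex.id_f, Category.comp_id]
    exact (E.M n).factors_self⟩
  comp {E F G} α β := ⟨α.φ ≫ β.φ, fun n => by
    rw [HomologicalComplex.comp_f, ← Category.assoc, ← Subobject.factorThru_arrow _ _ (α.factors n),
      Category.assoc]
    exact Subobject.factors_of_factors_right _ (β.factors n)⟩
  id_comp _ := Hom.ext (Category.id_comp _)
  comp_id _ := Hom.ext (Category.comp_id _)
  assoc _ _ _ := Hom.ext (Category.assoc _ _ _)

/-- The map `M i ⟶ E j / M j` induced by the differential `E i ⟶ E j`. -/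
def dbar (E : Dec A) (i j : ℤ) : (E.M i : A) ⟶ cokernel (E.M j).arrow :=
  (E.M i).arrow ≫ E.cx.d i j ≫ cokernel.π (E.M j).arrow

/-- `H^{-1,n}(E, M)`. -/
def Hm1 (E : Dec A) (n : ℤ) : A := kernel (E.dbar n (n + 1))

/-- `H^{0,n}(E, M)`. -/
def H0 (E : Dec A) (n : ℤ) : A := cokernel (E.dbar n (n + 1))

/-- The induced map `M n ⟶ N n`. -/
def mapM {E F : Dec A} (α : E ⟶ F) (n : ℤ) : (E.M n : A) ⟶ (F.M n : A) :=
  (F.M n).factorThru ((E.M n).arrow ≫ (Hom.φ α).f n) (Hom.factors α n)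

lemma mapM_arrow {E F : Dec A} (α : E ⟶ F) (n : ℤ) :
    mapM α n ≫ (F.M n).arrow = (E.M n).arrow ≫ (Hom.φ α).f n :=
  Subobject.factorThru_arrow _ _ _

/-- The induced map `E n / M n ⟶ F n / N n`. -/
def mapQ {E F : Dec A} (α : E ⟶ F) (n : ℤ) :
    cokernel (E.M n).arrow ⟶ cokernel (F.M n).arrow :=
  cokernel.map _ _ (mapM α n) ((Hom.φ α).f n) (mapM_arrow α n).symm

lemma dbar_comm {E F : Dec A} (α : E ⟶ F) (i j : ℤ) :
    E.dbar i j ≫ mapQ α j = mapM α i ≫ F.dbar i j := by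
  simp only [dbar, mapQ, Category.assoc, cokernel.π_desc]
  rw [← Category.assoc (mapM α i), mapM_arrow]
  simp

/-- The induced map on `H^{-1,n}`. -/
def mapHm1 {E F : Dec A} (α : E ⟶ F) (n : ℤ) : E.Hm1 n ⟶ F.Hm1 n :=
  kernel.map _ _ (mapM α n) (mapQ α (n + 1)) (dbar_comm α n (n + 1))

/-- The induced map on `H^{0,n}`. -/
def mapH0 {E F : Dec A} (α : E ⟶ F) (n : ℤ) : E.H0 n ⟶ F.H0 n :=
  cokernel.map _ _ (mapM α n) (mapQ α (n + 1)) (dbar_comm α n (n + 1))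

/-- Compatibility of the decoration with a torsion pair. -/
def compatible (t : TorsionPair A) : ObjectProperty (Dec A) := fun E =>
  ∀ n : ℤ, t.F (E.Hm1 n) ∧ t.T (E.H0 n)

/-- The reindexing `(E, M) ↦ (E', M')` with `E' n = E (n - 1)`, `M' n = M (n - 1)` and unchanged
differentials. -/
def reindex : Dec A ⥤ Dec A where
  obj E :=
    { cx :=
        { X := fun n => E.cx.X (n - 1)
          d := fun i j => E.cx.d (i - 1) (j - 1)
          shape := fun i j hij => E.cx.shape _ _ fun h => hij (by
            simp only [ComplexShape.up_Rel] at h ⊢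
            omega)
          d_comp_d' := fun _ _ _ _ _ => E.cx.d_comp_d _ _ _ }
      M := fun n => E.M (n - 1) }
  map α :=
    { φ :=
        { f := fun n => (Hom.φ α).f (n - 1)
          comm' := fun i j _ => (Hom.φ α).comm (i - 1) (j - 1) }
      factors := fun n => Hom.factors α (n - 1) }
  map_id _ := rfl
  map_comp _ _ := rfl

end Dec

/-- `Ch(A, 𝒯, ℱ)`: the full subcategory of decorated complexes whose decoration is compatible
with the torsion pair. -/
abbrev ChDec (t : TorsionPair A) := (Dec.compatible t).FullSubcategory

namespace ChDec

/-- Morphisms inducing isomorphisms on all `H^{-1,n}` and `H^{0,n}`. -/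
def sis (t : TorsionPair A) : MorphismProperty (ChDec t) := fun _ _ α =>
  ∀ n : ℤ, IsIso (Dec.mapHm1 α.hom n) ∧ IsIso (Dec.mapH0 α.hom n)

/-- Morphisms inducing isomorphisms on the usual cohomology. -/
def qis (t : TorsionPair A) : MorphismProperty (ChDec t) := fun _ _ α =>
  QuasiIso (Dec.Hom.φ α.hom)

end ChDec

/-! ### The functor `Tot` -/

namespace Tot

variable {t : TorsionPair A}

/-- A butterfly representing the differential from degree `n` to degree `n + 1`. -/
def rep (X : ChSt t) (n : ℤ) : Butterfly (X.cx.X n).arrow (X.cx.X (n + 1)).arrow :=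
  Tilt.out (X.cx.d n (n + 1))

lemma exists_link (X : ChSt t) (n : ℤ) : ∃ δ : (rep X n).E ⟶ (rep X (n + 1)).E,
    (rep X n).κ ≫ δ = 0 ∧ (rep X n).ι ≫ δ = (rep X (n + 1)).κ ∧
      δ ≫ (rep X (n + 1)).σ = (rep X n).ρ ∧ δ ≫ (rep X (n + 1)).ρ = 0 := by
  apply Butterfly.exists_link
  rw [← Tilt.ofB_eq_iff, ← Tilt.ofB_comp, rep, rep, Tilt.ofB_out, Tilt.ofB_out, ← Tilt.zero_def,
    X.cx.d_comp_d]

/-- The (unique) link between two consecutive differentials. -/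
def δ (X : ChSt t) (n : ℤ) : (rep X n).E ⟶ (rep X (n + 1)).E := (exists_link X n).choose

lemma κ_δ (X : ChSt t) (n : ℤ) : (rep X n).κ ≫ δ X n = 0 := (exists_link X n).choose_spec.1

lemma ι_δ (X : ChSt t) (n : ℤ) : (rep X n).ι ≫ δ X n = (rep X (n + 1)).κ :=
  (exists_link X n).choose_spec.2.1

lemma δ_σ (X : ChSt t) (n : ℤ) : δ X n ≫ (rep X (n + 1)).σ = (rep X n).ρ :=
  (exists_link X n).choose_spec.2.2.1

lemma δ_ρ (X : ChSt t) (n : ℤ) : δ X n ≫ (rep X (n + 1)).ρ = 0 :=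
  (exists_link X n).choose_spec.2.2.2

lemma δ_δ (X : ChSt t) (n : ℤ) : δ X n ≫ δ X (n + 1) = 0 := by
  refine Butterfly.eq_zero_of_torsion t (X.cx.X n).coker_mem (X.cx.X _).ker_mem _ ?_ ?_ ?_ ?_
  · rw [reassoc_of% κ_δ, zero_comp]
  · rw [reassoc_of% ι_δ, κ_δ]
  · rw [Category.assoc, δ_σ, δ_ρ]
  · rw [Category.assoc, δ_ρ, comp_zero]

lemma exists_map {X Y : ChSt t} (φ : X ⟶ Y) (n : ℤ) : ∃ g : (rep X n).E ⟶ (rep Y n).E,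
    (rep X n).κ ≫ g = (ChSt.Hom.f φ n).left ≫ (rep Y n).κ ∧
    (rep X n).ι ≫ g = (ChSt.Hom.f φ (n + 1)).left ≫ (rep Y n).ι ∧
    g ≫ (rep Y n).σ = (rep X n).σ ≫ (ChSt.Hom.f φ n).right ∧
    g ≫ (rep Y n).ρ = (rep X n).ρ ≫ (ChSt.Hom.f φ (n + 1)).right := by
  apply Butterfly.exists_map
  rw [← Tilt.ofB_eq_iff, ← Tilt.ofB_comp, ← Tilt.ofB_comp, rep, rep, Tilt.ofB_out, Tilt.ofB_out]
  exact (ChSt.Hom.comm φ n (n + 1)).symm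

/-- The (unique) map of middle objects induced by a strict morphism of complexes. -/
def map {X Y : ChSt t} (φ : X ⟶ Y) (n : ℤ) : (rep X n).E ⟶ (rep Y n).E :=
  (exists_map φ n).choose

section

variable {X Y Z : ChSt t} (φ : X ⟶ Y) (ψ : Y ⟶ Z) (n : ℤ)

lemma κ_map : (rep X n).κ ≫ map φ n = (ChSt.Hom.f φ n).left ≫ (rep Y n).κ :=
  (exists_map φ n).choose_spec.1

lemma ι_map : (rep X n).ι ≫ map φ n = (ChSt.Hom.f φ (n + 1)).left ≫ (rep Y n).ι :=
  (exists_map φ n).choose_spec.2.1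

lemma map_σ : map φ n ≫ (rep Y n).σ = (rep X n).σ ≫ (ChSt.Hom.f φ n).right :=
  (exists_map φ n).choose_spec.2.2.1

lemma map_ρ : map φ n ≫ (rep Y n).ρ = (rep X n).ρ ≫ (ChSt.Hom.f φ (n + 1)).right :=
  (exists_map φ n).choose_spec.2.2.2

lemma map_ext {g g' : (rep X n).E ⟶ (rep Y n).E} (h1 : (rep X n).κ ≫ g = (rep X n).κ ≫ g')
    (h2 : (rep X n).ι ≫ g = (rep X n).ι ≫ g') (h3 : g ≫ (rep Y n).σ = g' ≫ (rep Y n).σ)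
    (h4 : g ≫ (rep Y n).ρ = g' ≫ (rep Y n).ρ) : g = g' := by
  rw [← sub_eq_zero]
  refine Butterfly.eq_zero_of_torsion t (X.cx.X n).coker_mem (Y.cx.X _).ker_mem _ ?_ ?_ ?_ ?_
  · rw [Preadditive.comp_sub, h1, sub_self]
  · rw [Preadditive.comp_sub, h2, sub_self]
  · rw [Preadditive.sub_comp, h3, sub_self]
  · rw [Preadditive.sub_comp, h4, sub_self]

lemma map_δ : map φ n ≫ δ Y n = δ X n ≫ map φ (n + 1) := by
  rw [← sub_eq_zero]
  refine Butterfly.eq_zero_of_torsion t (X.cx.X n).coker_mem (Y.cx.X _).ker_mem _ ?_ ?_ ?_ ?_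
  · rw [Preadditive.comp_sub, reassoc_of% κ_map, κ_δ, reassoc_of% κ_δ, comp_zero, zero_comp,
      sub_zero]
  · rw [Preadditive.comp_sub, reassoc_of% ι_map, ι_δ, reassoc_of% ι_δ, κ_map, sub_self]
  · rw [Preadditive.sub_comp, Category.assoc, Category.assoc, δ_σ, map_ρ, map_σ,
      reassoc_of% δ_σ, sub_self]
  · rw [Preadditive.sub_comp, Category.assoc, Category.assoc, δ_ρ, map_ρ, reassoc_of% δ_ρ,
      comp_zero, zero_comp, sub_zero]

lemma factors_map :
    (Subobject.mk (rep Y n).ι).Factors ((Subobject.mk (rep X n).ι).arrow ≫ map φ n) := by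
  have h : ((Subobject.underlyingIso (rep X n).ι).hom ≫ (ChSt.Hom.f φ (n + 1)).left) ≫
      (rep Y n).ι = (Subobject.mk (rep X n).ι).arrow ≫ map φ n := by
    rw [Category.assoc, ← ι_map, Subobject.underlyingIso_hom_comp_eq_mk_assoc]
  exact (Subobject.mk_factors_iff _ _).2 ⟨_, h⟩

lemma map_id : map (𝟙 X) n = 𝟙 _ := by
  apply map_ext
  · rw [κ_map, Category.comp_id]; exact Category.id_comp _
  · rw [ι_map, Category.comp_id]; exact Category.id_comp _
  · rw [map_σ, Category.id_comp]; exact Category.comp_id _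
  · rw [map_ρ, Category.id_comp]; exact Category.comp_id _

lemma map_comp : map (φ ≫ ψ) n = map φ n ≫ map ψ n := by
  apply map_ext
  · rw [κ_map, reassoc_of% κ_map, κ_map, ← Category.assoc]; rfl
  · rw [ι_map, reassoc_of% ι_map, ι_map, ← Category.assoc]; rfl
  · rw [map_σ, Category.assoc, map_σ, reassoc_of% map_σ]; rfl
  · rw [map_ρ, Category.assoc, map_ρ, reassoc_of% map_ρ]; rfl

end

/-- The decorated complex with terms `(E n, ι (X^{n+1})⁻¹)`, where `E n` is the middle object of
the differential from degree `n` to degree `n + 1`, and with the links as differentials. -/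
def auxObj (X : ChSt t) : Dec A where
  cx := CochainComplex.of (fun n => (rep X n).E) (δ X) (δ_δ X)
  M := fun n => Subobject.mk (rep X n).ι

lemma auxObj_d (X : ChSt t) (n : ℤ) : (auxObj X).cx.d n (n + 1) = δ X n :=
  CochainComplex.of_d (fun n => (rep X n).E) (δ X) n

/-- The functor given by `Tot.auxObj`. -/
def aux (t : TorsionPair A) : ChSt t ⥤ Dec A where
  obj X := auxObj X
  map {X Y} φ :=
    { φ :=
        { f := map φ
          comm' := by
            rintro i _ rfl
            rw [auxObj_d, auxObj_d]
            exact map_δ φ i }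
      factors := factors_map φ }
  map_id X := Dec.Hom.ext (by ext n; exact map_id n)
  map_comp φ ψ := Dec.Hom.ext (by ext n; exact map_comp φ ψ n)

lemma ι_quot {X Y : Arrow A} (P : Butterfly X Y) :
    P.ι ≫ cokernel.π (Subobject.mk P.ι).arrow = 0 := by
  rw [← cancel_epi (Subobject.underlyingIso P.ι).hom,
    Subobject.underlyingIso_hom_comp_eq_mk_assoc, cokernel.condition, comp_zero]

/-- The middle object of a butterfly modulo the image of `ι`. -/
def quotIso {X Y : Arrow A} (P : Butterfly X Y) :
    cokernel (Subobject.mk P.ι).arrow ≅ X.right where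
  hom := cokernel.desc _ P.σ (by
    rw [← Subobject.underlyingIso_hom_comp_eq_mk, Category.assoc, P.ι_σ, comp_zero])
  inv := P.exact.exact.desc (cokernel.π _) (ι_quot P)
  hom_inv_id := by
    rw [← cancel_epi (cokernel.π _), cokernel.π_desc_assoc, Category.comp_id]
    exact P.exact.exact.g_desc _ _
  inv_hom_id := by
    rw [← cancel_epi P.σ, Category.comp_id]
    have h := P.exact.exact.g_desc (cokernel.π (Subobject.mk P.ι).arrow) (ι_quot P)
    rw [← Category.assoc]
    refine (congrArg (· ≫ _) h).trans ?_
    simp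

lemma dbar_auxObj (X : ChSt t) (i : ℤ) :
    (auxObj X).dbar i (i + 1) ≫ (quotIso (rep X (i + 1))).hom =
      (Subobject.underlyingIso (rep X i).ι).hom ≫ (X.cx.X (i + 1)).arrow.hom := by
  rw [Dec.dbar, auxObj_d]
  change ((Subobject.mk (rep X i).ι).arrow ≫ δ X i ≫ cokernel.π (Subobject.mk _).arrow) ≫
    cokernel.desc _ _ _ = _
  simp only [Category.assoc, cokernel.π_desc]
  rw [δ_σ, ← Butterfly.ι_ρ (rep X i), Subobject.underlyingIso_hom_comp_eq_mk_assoc]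

lemma ker_dbar_mem (X : ChSt t) (i j : ℤ) (h : j = i + 1) :
    t.F (kernel ((auxObj X).dbar i j)) ∧ t.T (cokernel ((auxObj X).dbar i j)) := by
  subst h
  have := t.F_iso
  have := t.T_iso
  exact ⟨t.F.prop_of_iso (kernel.mapIso _ _ _ _ (dbar_auxObj X i)).symm (X.cx.X (i + 1)).ker_mem,
    t.T.prop_of_iso (cokernel.mapIso _ _ _ _ (dbar_auxObj X i)).symm (X.cx.X (i + 1)).coker_mem⟩

end Tot

/-- The functor `Tot : Ch^st(B) ⥤ Ch(A, 𝒯, ℱ)`: the term of `Tot X` in degree `n` is the middle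
object of a butterfly representing the differential of `X` from degree `n - 1` to degree `n`, its
decoration in degree `n` is the image of `ι : (X^n)⁻¹ ⟶ E^n`, and its differentials are the
links. -/
def Tot (t : TorsionPair A) : ChSt t ⥤ ChDec t :=
  (Dec.compatible t).lift (Tot.aux t ⋙ Dec.reindex) fun X n =>
    Tot.ker_dbar_mem X (n - 1) (n + 1 - 1) (by omega)

end HRSTilt

end

noncomputable section

namespace HRSTilt

variable {A : Type u} [Category.{v} A] [Abelian A]

/-! ### Torsion pairs -/

namespace TorsionPair

variable (t : TorsionPair A)

/-! `Tot` has an explicit inverse. A decorated complex (E, M) gives the two-term complexes [M^n →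
E^{n+1}/M^{n+1}]. The object E^{n+1} is the middle of a butterfly from the n-th of these to the
next: one diagonal is M^{n+1} → E^{n+1} → E^{n+1}/M^{n+1}, the other is induced by the differential.
Consecutive butterflies compose to zero because the differential of E is a link between them
(`Butterfly.IsLink.comp_equiv_zero`).

The torsion pair makes links and induced maps unique: the difference of two candidates factors
through a morphism from a cokernel in 𝒯 to a kernel in ℱ (`Butterfly.eq_zero_of_torsion`). Hence
isomorphisms between butterflies automatically commute with links, which gives essential
surjectivity. A chain map respecting the decorations is the same as a family of strict morphisms: it
is read off on M and on E/M, and the links turn commutation with the differentials into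
compatibility with κ and ρ (`Tot.exists_hom_of_map`).

For `sis`: a butterfly is invertible in B exactly when its second diagonal is short exact too
(`Tilt.isIso_ofB_iff`). For a strict morphism that diagonal is the mapping cone, so invertibility
means inducing isomorphisms on kernels and cokernels of the two-term complexes, and these are
H^{-1,n} and H^{0,n}.

For `qis`: let W be the subobject of the middle object E of a butterfly with im κ ⊆ W ⊆ ker ρ whose
quotient by im κ is the torsion part of ker ρ / im κ, and let C = E/W (a `Cut`). Then [X⁻¹ → W] is
the kernel and [C → Y⁰] the cokernel in B. Let E^n be the middle object of the differential leaving
degree n. The link factors as E^n → C^n → W^{n+1} → E^{n+1}, and its central map m_n, as a two-term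
complex, is the cohomology in B in degree n + 1 (`Tilt.HomologyPresentation`). On the other hand 0 →
coker m_n → H^{n+1}(E) → ker m_{n+1} → 0 is the torsion sequence of the cohomology in A
(`HomologyCut.shortExact`). A morphism is invertible on an object with such a sequence if and only
if it is so on both ends. Therefore both kinds of quasi-isomorphism amount to isomorphisms on every
ker m_n and every coker m_n. -/

lemma exists_exact_sequence (X : A) : ∃ (T F : A) (i : T ⟶ X) (q : X ⟶ F) (hiq : i ≫ q = 0),
    (ShortComplex.mk i q hiq).ShortExact ∧ t.T T ∧ t.F F := by
  obtain ⟨S, hS, rfl, hT, hF⟩ := t.exists_shortExact X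
  exact ⟨S.X₁, S.X₃, S.f, S.g, S.zero, hS, hT, hF⟩

/-- The projection onto the torsion-free quotient vanishes, so the torsion subobject is everything.
-/
lemma T_of_hom_eq_zero {X : A} (h : ∀ {Y : A}, t.F Y → ∀ f : X ⟶ Y, f = 0) : t.T X := by
  obtain ⟨S, hS, rfl, hT, hF⟩ := t.exists_shortExact X
  have := t.T_iso
  have := hS.mono_f
  have : Epi S.f := hS.exact.epi_f (h hF _)
  have : IsIso S.f := isIso_of_mono_of_epi _
  exact t.T.prop_of_iso (asIso S.f) hT

lemma F_of_hom_eq_zero {Y : A} (h : ∀ {X : A}, t.T X → ∀ f : X ⟶ Y, f = 0) : t.F Y := by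
  obtain ⟨S, hS, rfl, hT, hF⟩ := t.exists_shortExact Y
  have := t.F_iso
  have := hS.epi_g
  have : Mono S.g := hS.exact.mono_g (h hT _)
  have : IsIso S.g := isIso_of_mono_of_epi _
  exact t.F.prop_of_iso (asIso S.g).symm hF

lemma T_of_epi {X Y : A} (f : X ⟶ Y) [Epi f] (hX : t.T X) : t.T Y :=
  t.T_of_hom_eq_zero fun hZ g => by
    rw [← cancel_epi f, t.hom_eq_zero hX hZ (f ≫ g), comp_zero]

lemma F_of_mono {X Y : A} (f : X ⟶ Y) [Mono f] (hY : t.F Y) : t.F X :=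
  t.F_of_hom_eq_zero fun hZ g => by
    rw [← cancel_mono f, t.hom_eq_zero hZ hY (g ≫ f), zero_comp]

/-- The kernel of the first factor embeds in the kernel of the composite, and ℱ is closed under
subobjects. -/
lemma F_kernel_of_comp {X Y Z : A} {f : X ⟶ Y} {g : Y ⟶ Z} {h : X ⟶ Z} (w : f ≫ g = h)
    (hh : t.F (kernel h)) : t.F (kernel f) := by
  have h0 : kernel.ι f ≫ h = 0 := by rw [← w, kernel.condition_assoc, zero_comp]
  have : Mono (kernel.lift h _ h0 ≫ kernel.ι h) := by rw [kernel.lift_ι]; infer_instance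
  have := mono_of_mono (kernel.lift h _ h0) (kernel.ι h)
  exact t.F_of_mono (kernel.lift h _ h0) hh

lemma T_cokernel_of_comp {X Y Z : A} {f : X ⟶ Y} {g : Y ⟶ Z} {h : X ⟶ Z} (w : f ≫ g = h)
    (hh : t.T (cokernel h)) : t.T (cokernel g) := by
  have h0 : h ≫ cokernel.π g = 0 := by rw [← w, Category.assoc, cokernel.condition, comp_zero]
  have : Epi (cokernel.π h ≫ cokernel.desc h _ h0) := by rw [cokernel.π_desc]; infer_instance
  have := epi_of_epi (cokernel.π h) (cokernel.desc h _ h0)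
  exact t.T_of_epi (cokernel.desc h _ h0) hh

/-- A map that vanishes on a subobject with torsion quotient and whose composition with a map
with torsion-free kernel is zero vanishes. -/
lemma eq_zero_of_comp_eq_zero {U W C V : A} {k : U ⟶ W} {c : C ⟶ V} (hk : t.T (cokernel k))
    (hc : t.F (kernel c)) (x : W ⟶ C) (h₁ : k ≫ x = 0) (h₂ : x ≫ c = 0) : x = 0 := by
  have h : cokernel.desc k x h₁ ≫ c = 0 := by
    rw [← cancel_epi (cokernel.π k), cokernel.π_desc_assoc, h₂, comp_zero]
  have h0 := t.hom_eq_zero hk hc (kernel.lift c _ h)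
  rw [← cokernel.π_desc k x h₁, ← kernel.lift_ι c _ h, h0, zero_comp, comp_zero]

end TorsionPair

/-! ### Cutting a two-step complex along a torsion pair -/

/-- For `a : U ⟶ E` and `b : E ⟶ V`, a subobject `W` of `E`, with quotient `C`, that contains the
image of `a` with torsion quotient and is contained in the kernel of `b` with torsion-free
quotient. -/
structure Cut (t : TorsionPair A) {U E V : A} (a : U ⟶ E) (b : E ⟶ V) where
  W : A
  C : A
  k : U ⟶ W
  w : W ⟶ E
  p : E ⟶ C
  c : C ⟶ V
  w_p : w ≫ p = 0
  exact : (ShortComplex.mk w p w_p).ShortExact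
  k_w : k ≫ w = a
  p_c : p ≫ c = b
  T_mem : t.T (cokernel k)
  F_mem : t.F (kernel c)

namespace Cut

variable {t : TorsionPair A}

section

variable {U E V : A} {a : U ⟶ E} {b : E ⟶ V}

instance (D : Cut t a b) : Mono D.w := D.exact.mono_f

instance (D : Cut t a b) : Epi D.p := D.exact.epi_g

lemma w_b (D : Cut t a b) : D.w ≫ b = 0 :=
  (D.w ≫= D.p_c).symm.trans (by rw [reassoc_of% D.w_p, zero_comp])

lemma a_p (D : Cut t a b) : a ≫ D.p = 0 :=
  (D.k_w =≫ D.p).symm.trans (by rw [Category.assoc, D.w_p, comp_zero])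

lemma exists_lift (D : Cut t a b) {S : A} (x : S ⟶ E) (h : x ≫ D.p = 0) :
    ∃ y : S ⟶ D.W, y ≫ D.w = x :=
  ⟨D.exact.exact.lift x h, D.exact.exact.lift_f x h⟩

lemma exists_desc (D : Cut t a b) {S : A} (x : E ⟶ S) (h : D.w ≫ x = 0) :
    ∃ y : D.C ⟶ S, D.p ≫ y = x :=
  ⟨D.exact.exact.desc x h, D.exact.exact.g_desc x h⟩

/-- W is the preimage in ker b of the torsion subobject T of ker b / im a. Then W / im a is T, and
the kernel of E/W → V is ker b / W, the torsion-free quotient F. -/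
lemma nonempty (t : TorsionPair A) (h : a ≫ b = 0) : Nonempty (Cut t a b) := by
  obtain ⟨a', ha'⟩ : ∃ a' : U ⟶ kernel b, a' ≫ kernel.ι b = a := ⟨kernel.lift b a h, by simp⟩
  obtain ⟨T, F, i, q, hiq, hS, hT, hF⟩ := t.exists_exact_sequence (cokernel a')
  have : Mono i := hS.mono_f
  let fst : pullback i (cokernel.π a') ⟶ T := pullback.fst _ _
  let snd : pullback i (cokernel.π a') ⟶ kernel b := pullback.snd _ _
  have hcond : fst ≫ i = snd ≫ cokernel.π a' := pullback.condition
  have : Mono snd := inferInstanceAs (Mono (pullback.snd _ _))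
  have : Epi fst := inferInstanceAs (Epi (pullback.fst _ _))
  obtain ⟨k, hk1, hk2⟩ : ∃ k : U ⟶ pullback i (cokernel.π a'), k ≫ fst = 0 ∧ k ≫ snd = a' :=
    ⟨pullback.lift 0 a' (by simp), pullback.lift_fst _ _ _, pullback.lift_snd _ _ _⟩
  obtain ⟨w, hw⟩ : ∃ w, snd ≫ kernel.ι b = w := ⟨_, rfl⟩
  have : Mono w := by rw [← hw]; infer_instance
  have hwb : w ≫ b = 0 := by rw [← hw, Category.assoc, kernel.condition, comp_zero]
  have hSE : (ShortComplex.mk w (cokernel.π w) (cokernel.condition w)).ShortExact :=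
    { exact := ShortComplex.exact_cokernel w }
  refine ⟨⟨_, _, k, w, cokernel.π w, cokernel.desc w b hwb, cokernel.condition w, hSE, ?_,
    cokernel.π_desc _ _ _, ?_, ?_⟩⟩
  · rw [← hw, reassoc_of% hk2, ha']
  -- The cokernel of `k` is identified with T: the kernel of `fst` consists of what `snd` sends into
  -- the image of `a'`, hence is the image of `k`.
  · have : Epi (cokernel.desc k fst hk1) := by
      have : Epi (cokernel.π k ≫ cokernel.desc k fst hk1) := by rwa [cokernel.π_desc]
      exact epi_of_epi (cokernel.π k) _
    have : Mono (cokernel.desc k fst hk1) := by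
      rw [Preadditive.mono_iff_cancel_zero]
      intro S z hz
      obtain ⟨S', π, _, y, hy⟩ := surjective_up_to_refinements_of_epi (cokernel.π k) z
      have hy1 : y ≫ fst = 0 := by
        rw [← cokernel.π_desc k fst hk1, ← reassoc_of% hy, hz, comp_zero]
      have hy2 : (y ≫ snd) ≫ cokernel.π a' = 0 := by
        rw [Category.assoc, ← hcond, reassoc_of% hy1, zero_comp]
      obtain ⟨S'', π', _, x, hx⟩ :=
        (ShortComplex.exact_cokernel a').exact_up_to_refinements _ hy2
      have hx' : π' ≫ y = x ≫ k := by
        rw [← cancel_mono snd, Category.assoc, Category.assoc, hk2]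
        exact hx
      rw [← cancel_epi π, ← cancel_epi π', hy, reassoc_of% hx', cokernel.condition]
      simp
    have := isIso_of_mono_of_epi (cokernel.desc k fst hk1)
    have := t.T_iso
    exact t.T.prop_of_iso (asIso (cokernel.desc k fst hk1)).symm hT
  · obtain ⟨c, hc⟩ : ∃ c, cokernel.desc w b hwb = c := ⟨_, rfl⟩
    have hpc : cokernel.π w ≫ c = b := by rw [← hc, cokernel.π_desc]
    rw [hc]
    -- `e` is the surjection ker b → ker c with kernel W.
    obtain ⟨e, he⟩ : ∃ e : kernel b ⟶ kernel c, e ≫ kernel.ι c = kernel.ι b ≫ cokernel.π w :=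
      ⟨kernel.lift c (kernel.ι b ≫ cokernel.π w) (by simp [hpc]), kernel.lift_ι _ _ _⟩
    have : Epi e := by
      rw [epi_iff_surjective_up_to_refinements]
      intro S z
      obtain ⟨S', π, hπ, y, hy⟩ :=
        surjective_up_to_refinements_of_epi (cokernel.π w) (z ≫ kernel.ι c)
      have hy1 : y ≫ b = 0 := by rw [← hpc, ← reassoc_of% hy]; simp
      refine ⟨S', π, hπ, kernel.lift b y hy1, ?_⟩
      rw [← cancel_mono (kernel.ι c), Category.assoc, Category.assoc, he, hy,
        kernel.lift_ι_assoc]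
    -- `e` and the map ker b → F have the same kernel, so ker c embeds in F. This already puts ker c
    -- in ℱ, and surjectivity onto F is not needed.
    have hW : ∀ {S : A} (x : S ⟶ kernel b), x ≫ e = 0 ↔ x ≫ cokernel.π a' ≫ q = 0 := by
      intro S x
      constructor
      · intro hx
        have hx1 : (x ≫ kernel.ι b) ≫ cokernel.π w = 0 := by
          rw [Category.assoc, ← he, reassoc_of% hx, zero_comp]
        have hx2 : x = hSE.exact.lift _ hx1 ≫ snd := by
          rw [← cancel_mono (kernel.ι b), Category.assoc, hw]
          exact (hSE.exact.lift_f _ hx1).symm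
        rw [hx2, Category.assoc, ← reassoc_of% hcond, hiq, comp_zero, comp_zero]
      · intro hx
        have hx1 : (x ≫ cokernel.π a') ≫ q = 0 := by rw [Category.assoc, hx]
        obtain ⟨z, hz⟩ : ∃ z : S ⟶ pullback i (cokernel.π a'), z ≫ snd = x :=
          ⟨pullback.lift (hS.exact.lift _ hx1) x (hS.exact.lift_f _ hx1),
            pullback.lift_snd _ _ _⟩
        rw [← cancel_mono (kernel.ι c), ← hz, Category.assoc, Category.assoc, he,
          reassoc_of% hw, cokernel.condition]
        simp
    have hker : kernel.ι e ≫ cokernel.π a' ≫ q = 0 := (hW _).1 (kernel.condition e)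
    have : Mono (Abelian.epiDesc e _ hker) := by
      rw [Preadditive.mono_iff_cancel_zero]
      intro S z hz
      obtain ⟨S', π, _, y, hy⟩ := surjective_up_to_refinements_of_epi e z
      have : y ≫ cokernel.π a' ≫ q = 0 := by
        rw [← Abelian.comp_epiDesc e _ hker, ← reassoc_of% hy, hz, comp_zero]
      rw [← cancel_epi π, hy, (hW y).2 this, comp_zero]
    exact t.F_of_mono (Abelian.epiDesc e _ hker) hF

/-- A cut of `(a, b)`. -/
def ofZero (t : TorsionPair A) (h : a ≫ b = 0) : Cut t a b := (nonempty t h).some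

end

section

variable {U E V U' E' V' : A} {a : U ⟶ E} {b : E ⟶ V} {a' : U' ⟶ E'} {b' : E' ⟶ V'}
  (D : Cut t a b) (D' : Cut t a' b') {x : U ⟶ U'} {y : E ⟶ E'} {z : V ⟶ V'}

/-- The map W → C' induced by `y` vanishes on U and dies in V', so it factors through a morphism
from coker k, which is torsion, to ker c', which is torsion-free. -/
lemma w_comp_p (h₁ : a ≫ y = x ≫ a') (h₂ : y ≫ b' = b ≫ z) : D.w ≫ y ≫ D'.p = 0 := by
  refine t.eq_zero_of_comp_eq_zero D.T_mem D'.F_mem _ ?_ ?_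
  · rw [reassoc_of% D.k_w, reassoc_of% h₁, D'.a_p, comp_zero]
  · rw [Category.assoc, Category.assoc, D'.p_c, h₂, reassoc_of% D.w_b, zero_comp]

/-- Cuts are functorial. -/
lemma exists_map (h₁ : a ≫ y = x ≫ a') (h₂ : y ≫ b' = b ≫ z) :
    ∃ (f : D.W ⟶ D'.W) (g : D.C ⟶ D'.C), f ≫ D'.w = D.w ≫ y ∧ D.p ≫ g = y ≫ D'.p ∧
      D.k ≫ f = x ≫ D'.k ∧ g ≫ D'.c = D.c ≫ z := by
  obtain ⟨f, hf⟩ := D'.exists_lift (D.w ≫ y) (by rw [Category.assoc, w_comp_p D D' h₁ h₂])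
  obtain ⟨g, hg⟩ := D.exists_desc (y ≫ D'.p) (w_comp_p D D' h₁ h₂)
  refine ⟨f, g, hf, hg, ?_, ?_⟩
  · rw [← cancel_mono D'.w, Category.assoc, hf, reassoc_of% D.k_w, h₁, Category.assoc, D'.k_w]
  · rw [← cancel_epi D.p, reassoc_of% hg, D'.p_c, h₂, reassoc_of% D.p_c]

end

end Cut

/-! ### Kernels and cokernels in the tilted category -/

namespace Butterfly

section

variable {X Y Z : Arrow A}

/-- Such a `w` is a null-homotopy: together with `P.ι` it maps the middle object of the zero
butterfly to `P.E`, which is what `ofHom_comp_equiv` asks for. -/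
lemma ofHom_comp_equiv_zero {f : X ⟶ Y} {P : Butterfly Y Z} (w : X.right ⟶ P.E)
    (h₁ : X.hom ≫ w = f.left ≫ P.κ) (h₂ : w ≫ P.σ = f.right) (h₃ : w ≫ P.ρ = 0) :
    comp (ofHom f) P ≈ ofHom (zeroHom X Z) := by
  refine ofHom_comp_equiv (biprod.desc w P.ι) ?_ ?_ ?_ ?_
  · simp [zeroHom, biprod.lift_desc, h₁]
  · simp
  · apply biprod.hom_ext' <;> simp [h₂, P.ι_σ]
  · apply biprod.hom_ext' <;> simp [zeroHom, P.ι_ρ, h₃]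

lemma comp_ofHom_equiv_zero {P : Butterfly X Y} {f : Y ⟶ Z} (p : P.E ⟶ Z.left)
    (h₁ : P.κ ≫ p = 0) (h₂ : P.ι ≫ p = f.left) (h₃ : p ≫ Z.hom = P.ρ ≫ f.right) :
    comp P (ofHom f) ≈ ofHom (zeroHom X Z) := by
  refine comp_ofHom_equiv (biprod.lift P.σ p) ?_ ?_ ?_ ?_
  · apply biprod.hom_ext <;> simp [zeroHom, P.κ_σ, h₁]
  · apply biprod.hom_ext <;> simp [h₂, P.ι_σ]
  · simp
  · simp [zeroHom, biprod.lift_desc, h₃]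

end

variable {t : TorsionPair A} {X Y S : Arrow A} {P : Butterfly X Y}

/-- The inclusion of the kernel, as a morphism of two-term complexes. -/
def kerι (D : Cut t P.κ P.ρ) : Arrow.mk D.k ⟶ X :=
  Arrow.homMk (𝟙 X.left) (D.w ≫ P.σ) (by simp [reassoc_of% D.k_w, P.κ_σ])

/-- The projection onto the cokernel, as a morphism of two-term complexes. -/
def cokerπ (D : Cut t P.κ P.ρ) : Y ⟶ Arrow.mk D.c :=
  Arrow.homMk (P.ι ≫ D.p) (𝟙 Y.right) (by simp [D.p_c, P.ι_ρ])

lemma kerι_comp (D : Cut t P.κ P.ρ) :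
    comp (ofHom (kerι D)) P ≈ ofHom (zeroHom (Arrow.mk D.k) Y) :=
  ofHom_comp_equiv_zero D.w (by simp [kerι, D.k_w]) (by simp [kerι]) D.w_b

lemma comp_cokerπ (D : Cut t P.κ P.ρ) :
    comp P (ofHom (cokerπ D)) ≈ ofHom (zeroHom X (Arrow.mk D.c)) :=
  comp_ofHom_equiv_zero D.p D.a_p (by simp [cokerπ]) (by simp [cokerπ, D.p_c])

/-- The morphism to the kernel given by a link. -/
def kerLift (D : Cut t P.κ P.ρ) (Q : Butterfly S X) (d : Q.E ⟶ D.W)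
    (h₁ : Q.κ ≫ d = 0) (h₂ : Q.ι ≫ d = D.k) : Butterfly S (Arrow.mk D.k) where
  E := Q.E
  κ := Q.κ
  ι := Q.ι
  σ := Q.σ
  ρ := d
  κ_σ := Q.κ_σ
  ι_ρ := h₂
  κ_ρ := h₁
  ι_σ := Q.ι_σ
  exact := Q.exact

lemma kerLift_comp (D : Cut t P.κ P.ρ) (Q : Butterfly S X) (d : Q.E ⟶ D.W)
    (h₁ : Q.κ ≫ d = 0) (h₂ : Q.ι ≫ d = D.k) (h₃ : d ≫ D.w ≫ P.σ = Q.ρ) :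
    comp (kerLift D Q d h₁ h₂) (ofHom (kerι D)) ≈ Q :=
  comp_ofHom_equiv (𝟙 Q.E) (Category.comp_id Q.κ)
    ((Category.comp_id Q.ι).trans (Category.id_comp _).symm) (Category.id_comp Q.σ)
    ((Category.id_comp Q.ρ).trans h₃.symm)

/-- The morphism from the cokernel given by a link. -/
def cokerDesc (D : Cut t P.κ P.ρ) (Q : Butterfly Y S) (d : D.C ⟶ Q.E)
    (h₁ : d ≫ Q.σ = D.c) (h₂ : d ≫ Q.ρ = 0) : Butterfly (Arrow.mk D.c) S where
  E := Q.E
  κ := d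
  ι := Q.ι
  σ := Q.σ
  ρ := Q.ρ
  κ_σ := h₁
  ι_ρ := Q.ι_ρ
  κ_ρ := h₂
  ι_σ := Q.ι_σ
  exact := Q.exact

lemma comp_cokerDesc (D : Cut t P.κ P.ρ) (Q : Butterfly Y S) (d : D.C ⟶ Q.E)
    (h₁ : d ≫ Q.σ = D.c) (h₂ : d ≫ Q.ρ = 0) (h₃ : P.ι ≫ D.p ≫ d = Q.κ) :
    comp (ofHom (cokerπ D)) (cokerDesc D Q d h₁ h₂) ≈ Q :=
  ofHom_comp_equiv (𝟙 Q.E)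
    ((Category.comp_id Q.κ).trans (h₃.symm.trans (Category.assoc _ _ _).symm))
    (Category.comp_id Q.ι) ((Category.id_comp Q.σ).trans (Category.comp_id _).symm)
    (Category.id_comp Q.ρ)

/-- The composite of δ with the projection to C descends to S⁰ → C. There it vanishes on the image
of S⁻¹ and dies in Y⁰, so it is zero by torsion, and δ lands in W. Combined with `exists_link`, this
is the existence part of the universal property of the kernel. -/
lemma exists_link_lift (D : Cut t P.κ P.ρ) {Q : Butterfly S X} (hS : t.T (cokernel S.hom))
    {δ : Q.E ⟶ P.E} (hκ : Q.κ ≫ δ = 0) (hι : Q.ι ≫ δ = P.κ) (hρ : δ ≫ P.ρ = 0) :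
    ∃ d : Q.E ⟶ D.W, d ≫ D.w = δ ∧ Q.κ ≫ d = 0 ∧ Q.ι ≫ d = D.k := by
  obtain ⟨d, hd⟩ : ∃ d, d ≫ D.w = δ := by
    apply D.exists_lift
    have h : Q.ι ≫ δ ≫ D.p = 0 := by rw [reassoc_of% hι, D.a_p]
    obtain ⟨y, hy⟩ : ∃ y, Q.σ ≫ y = δ ≫ D.p :=
      ⟨Q.exact.exact.desc _ h, Q.exact.exact.g_desc _ h⟩
    rw [← hy, t.eq_zero_of_comp_eq_zero hS D.F_mem y, comp_zero]
    · rw [← Q.κ_σ, Category.assoc, hy, reassoc_of% hκ, zero_comp]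
    · rw [← cancel_epi Q.σ, reassoc_of% hy, D.p_c, hρ, comp_zero]
  refine ⟨d, hd, ?_, ?_⟩
  · rw [← cancel_mono D.w, Category.assoc, hd, hκ, zero_comp]
  · rw [← cancel_mono D.w, Category.assoc, hd, hι, D.k_w]

/-- Dual argument: the restriction of δ to W lifts to W → S⁻¹ and vanishes by torsion, so δ descends
to C. -/
lemma exists_link_desc (D : Cut t P.κ P.ρ) {Q : Butterfly Y S} (hS : t.F (kernel S.hom))
    {δ : P.E ⟶ Q.E} (hκ : P.κ ≫ δ = 0) (hσ : δ ≫ Q.σ = P.ρ) (hρ : δ ≫ Q.ρ = 0) :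
    ∃ d : D.C ⟶ Q.E, D.p ≫ d = δ ∧ d ≫ Q.σ = D.c ∧ d ≫ Q.ρ = 0 := by
  obtain ⟨d, hd⟩ : ∃ d, D.p ≫ d = δ := by
    apply D.exists_desc
    have h : (D.w ≫ δ) ≫ Q.σ = 0 := by rw [Category.assoc, hσ, D.w_b]
    obtain ⟨y, hy⟩ : ∃ y, y ≫ Q.ι = D.w ≫ δ :=
      ⟨Q.exact.exact.lift _ h, Q.exact.exact.lift_f _ h⟩
    rw [← hy, t.eq_zero_of_comp_eq_zero D.T_mem hS y, zero_comp]
    · rw [← cancel_mono Q.ι, Category.assoc, hy, reassoc_of% D.k_w, hκ, zero_comp]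
    · rw [← Q.ι_ρ, reassoc_of% hy, hρ, comp_zero]
  refine ⟨d, hd, ?_, ?_⟩
  · rw [← cancel_epi D.p, reassoc_of% hd, hσ, D.p_c]
  · rw [← cancel_epi D.p, reassoc_of% hd, hρ, comp_zero]

/-- This makes the kernel inclusion a monomorphism in B. Composing with it changes only the arrow ρ
of a butterfly, so what has to be shown is that an isomorphism of the composites already respects
the original ρ. -/
lemma equiv_of_comp_kerι (D : Cut t P.κ P.ρ) (hS : t.T (cokernel S.hom))
    (hY : t.F (kernel Y.hom)) {Q₁ Q₂ : Butterfly S (Arrow.mk D.k)}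
    (h : comp Q₁ (ofHom (kerι D)) ≈ comp Q₂ (ofHom (kerι D))) : Q₁ ≈ Q₂ := by
  let R (Q : Butterfly S (Arrow.mk D.k)) : Butterfly S X :=
    { E := Q.E
      κ := Q.κ
      ι := Q.ι
      σ := Q.σ
      ρ := Q.ρ ≫ D.w ≫ P.σ
      κ_σ := Q.κ_σ
      ι_ρ := by
        rw [← P.κ_σ, ← reassoc_of% D.k_w]
        exact (reassoc_of% Q.ι_ρ) _
      κ_ρ := by rw [reassoc_of% Q.κ_ρ, zero_comp]
      ι_σ := Q.ι_σ
      exact := Q.exact }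
  have hR (Q : Butterfly S (Arrow.mk D.k)) : comp Q (ofHom (kerι D)) ≈ R Q :=
    comp_ofHom_equiv (𝟙 _) (by simp [R]) (by simp [R, kerι]) (by simp [R]) (by simp [R, kerι])
  obtain ⟨e, h1, h2, h3, h4⟩ : R Q₁ ≈ R Q₂ :=
    Setoid.trans (Setoid.symm (hR Q₁)) (Setoid.trans h (hR Q₂))
  change Q₁.E ≅ Q₂.E at e
  change Q₁.κ ≫ e.hom = Q₂.κ at h1
  change Q₁.ι ≫ e.hom = Q₂.ι at h2
  change e.hom ≫ Q₂.σ = Q₁.σ at h3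
  change e.hom ≫ Q₂.ρ ≫ D.w ≫ P.σ = Q₁.ρ ≫ D.w ≫ P.σ at h4
  refine ⟨e, h1, h2, h3, ?_⟩
  -- The defect of `e` with respect to ρ descends to `a` on S⁰. After inclusion in the middle object
  -- of `P` it lifts to `b : S⁰ ⟶ Y⁻¹`, which is zero since it factors from a torsion cokernel to a
  -- torsion-free kernel.
  have hι : Q₁.ι ≫ (e.hom ≫ Q₂.ρ - Q₁.ρ) = 0 := by
    rw [Preadditive.comp_sub, reassoc_of% h2, Q₁.ι_ρ, Q₂.ι_ρ, sub_self]
  obtain ⟨a, ha⟩ : ∃ a, Q₁.σ ≫ a = e.hom ≫ Q₂.ρ - Q₁.ρ :=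
    ⟨Q₁.exact.exact.desc _ hι, Q₁.exact.exact.g_desc _ hι⟩
  have haκ : S.hom ≫ a = 0 := by
    rw [← Q₁.κ_σ, Category.assoc, ha, Preadditive.comp_sub, reassoc_of% h1, Q₁.κ_ρ, Q₂.κ_ρ,
      sub_self]
  have haσ : (a ≫ D.w) ≫ P.σ = 0 := by
    rw [← cancel_epi Q₁.σ, ← Category.assoc, ← Category.assoc, ha]
    simp [h4]
  obtain ⟨b, hb⟩ : ∃ b, b ≫ P.ι = a ≫ D.w :=
    ⟨P.exact.exact.lift _ haσ, P.exact.exact.lift_f _ haσ⟩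
  have hb0 : b = 0 := by
    refine t.eq_zero_of_comp_eq_zero hS hY b ?_ ?_
    · rw [← cancel_mono P.ι, Category.assoc, hb, reassoc_of% haκ, zero_comp, zero_comp]
    · rw [← P.ι_ρ, reassoc_of% hb, D.w_b, comp_zero]
  have ha0 : a = 0 := by
    rw [← cancel_mono D.w]
    exact hb.symm.trans (by rw [hb0, zero_comp, zero_comp])
  rw [ha0, comp_zero] at ha
  exact sub_eq_zero.1 ha.symm

lemma equiv_of_cokerπ_comp (D : Cut t P.κ P.ρ) (hX : t.T (cokernel X.hom))
    (hS : t.F (kernel S.hom)) {Q₁ Q₂ : Butterfly (Arrow.mk D.c) S}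
    (h : comp (ofHom (cokerπ D)) Q₁ ≈ comp (ofHom (cokerπ D)) Q₂) : Q₁ ≈ Q₂ := by
  let R (Q : Butterfly (Arrow.mk D.c) S) : Butterfly Y S :=
    { E := Q.E
      κ := P.ι ≫ D.p ≫ Q.κ
      ι := Q.ι
      σ := Q.σ
      ρ := Q.ρ
      κ_σ := by
        rw [← P.ι_ρ, Category.assoc, Category.assoc, Q.κ_σ]
        exact P.ι ≫= D.p_c
      ι_ρ := Q.ι_ρ
      κ_ρ := by rw [Category.assoc, Category.assoc, Q.κ_ρ, comp_zero, comp_zero]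
      ι_σ := Q.ι_σ
      exact := Q.exact }
  have hR (Q : Butterfly (Arrow.mk D.c) S) : comp (ofHom (cokerπ D)) Q ≈ R Q :=
    ofHom_comp_equiv (𝟙 _) (by simp [R, cokerπ]) (by simp [R]) (by simp [R, cokerπ])
      (by simp [R])
  obtain ⟨e, h1, h2, h3, h4⟩ : R Q₁ ≈ R Q₂ :=
    Setoid.trans (Setoid.symm (hR Q₁)) (Setoid.trans h (hR Q₂))
  change Q₁.E ≅ Q₂.E at e
  change (P.ι ≫ D.p ≫ Q₁.κ) ≫ e.hom = P.ι ≫ D.p ≫ Q₂.κ at h1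
  change Q₁.ι ≫ e.hom = Q₂.ι at h2
  change e.hom ≫ Q₂.σ = Q₁.σ at h3
  change e.hom ≫ Q₂.ρ = Q₁.ρ at h4
  refine ⟨e, ?_, h2, h3, h4⟩
  -- Dually, the defect with respect to κ lifts to `a : C ⟶ S⁻¹`, and its pullback to the middle
  -- object of `P` descends to `b : X⁰ ⟶ S⁻¹`, which is zero by torsion.
  have hσ : (Q₁.κ ≫ e.hom - Q₂.κ) ≫ Q₂.σ = 0 := by
    rw [Preadditive.sub_comp, Category.assoc, h3, Q₁.κ_σ, Q₂.κ_σ, sub_self]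
  obtain ⟨a, ha⟩ : ∃ a, a ≫ Q₂.ι = Q₁.κ ≫ e.hom - Q₂.κ :=
    ⟨Q₂.exact.exact.lift _ hσ, Q₂.exact.exact.lift_f _ hσ⟩
  have haρ : a ≫ S.hom = 0 := by
    rw [← Q₂.ι_ρ, reassoc_of% ha, Preadditive.sub_comp, Category.assoc, h4, Q₁.κ_ρ, Q₂.κ_ρ,
      sub_self]
  have haι : P.ι ≫ D.p ≫ a = 0 := by
    rw [← cancel_mono Q₂.ι, Category.assoc, Category.assoc, ha]
    simp only [Category.assoc] at h1
    simp [h1]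
  obtain ⟨b, hb⟩ : ∃ b, P.σ ≫ b = D.p ≫ a :=
    ⟨P.exact.exact.desc _ haι, P.exact.exact.g_desc _ haι⟩
  have hb0 : b = 0 := by
    refine t.eq_zero_of_comp_eq_zero hX hS b ?_ ?_
    · rw [← P.κ_σ, Category.assoc, hb, reassoc_of% D.a_p, zero_comp]
    · rw [← cancel_epi P.σ, reassoc_of% hb, haρ, comp_zero, comp_zero]
  have ha0 : a = 0 := by
    rw [← cancel_epi D.p]
    exact hb.symm.trans (by rw [hb0, comp_zero, comp_zero])
  rw [ha0, zero_comp] at ha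
  exact sub_eq_zero.1 ha.symm

end Butterfly

namespace Tilt

variable {t : TorsionPair A} {X Y : Tilt t} {P : Butterfly X.arrow Y.arrow}

/-- The kernel of a morphism of `B`. -/
def kerObj (D : Cut t P.κ P.ρ) : Tilt t where
  arrow := Arrow.mk D.k
  ker_mem := t.F_kernel_of_comp (g := D.w ≫ P.σ) (((reassoc_of% D.k_w) _).trans P.κ_σ) X.ker_mem
  coker_mem := D.T_mem

/-- The cokernel of a morphism of `B`. -/
def cokerObj (D : Cut t P.κ P.ρ) : Tilt t where
  arrow := Arrow.mk D.c
  ker_mem := D.F_mem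
  coker_mem := t.T_cokernel_of_comp (f := P.ι ≫ D.p)
    (by rw [Category.assoc]; exact (P.ι ≫= D.p_c).trans P.ι_ρ) Y.coker_mem

/-- The inclusion of the kernel. -/
def kerHom (D : Cut t P.κ P.ρ) : kerObj D ⟶ X :=
  strict (X := kerObj D) (Y := X) (Butterfly.kerι D)

/-- The projection onto the cokernel. -/
def cokerHom (D : Cut t P.κ P.ρ) : Y ⟶ cokerObj D :=
  strict (X := Y) (Y := cokerObj D) (Butterfly.cokerπ D)

lemma kerHom_comp (D : Cut t P.κ P.ρ) : kerHom D ≫ ofB P = 0 :=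
  Quotient.sound (Butterfly.kerι_comp D)

lemma comp_cokerHom (D : Cut t P.κ P.ρ) : ofB P ≫ cokerHom D = 0 :=
  Quotient.sound (Butterfly.comp_cokerπ D)

instance (D : Cut t P.κ P.ρ) : Mono (kerHom D) where
  right_cancellation {S} f g h := by
    rw [← ofB_out f, ← ofB_out g] at h ⊢
    exact Quotient.sound (Butterfly.equiv_of_comp_kerι D S.coker_mem Y.ker_mem
      ((ofB_eq_iff (X := S) (Y := X) _ _).1 h))

instance (D : Cut t P.κ P.ρ) : Epi (cokerHom D) where
  left_cancellation {S} f g h := by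
    rw [← ofB_out f, ← ofB_out g] at h ⊢
    exact Quotient.sound (Butterfly.equiv_of_cokerπ_comp D X.coker_mem S.ker_mem
      ((ofB_eq_iff (X := Y) (Y := S) _ _).1 h))

lemma exists_kerLift (D : Cut t P.κ P.ρ) {S : Tilt t} (f : S ⟶ X) (h : f ≫ ofB P = 0) :
    ∃ g : S ⟶ kerObj D, g ≫ kerHom D = f := by
  rw [← ofB_out f] at h ⊢
  rw [zero_def, ofB_comp, ofB_eq_iff] at h
  obtain ⟨δ, h1, h2, h3, h4⟩ := Butterfly.exists_link h
  obtain ⟨d, hd, hd1, hd2⟩ := Butterfly.exists_link_lift D S.coker_mem h1 h2 h4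
  exact ⟨ofB (Y := kerObj D) (Butterfly.kerLift D _ d hd1 hd2), Quotient.sound
    (Butterfly.kerLift_comp D _ d hd1 hd2 (by rw [reassoc_of% hd, h3]))⟩

lemma exists_cokerDesc (D : Cut t P.κ P.ρ) {S : Tilt t} (f : Y ⟶ S) (h : ofB P ≫ f = 0) :
    ∃ g : cokerObj D ⟶ S, cokerHom D ≫ g = f := by
  rw [← ofB_out f] at h ⊢
  rw [zero_def, ofB_comp, ofB_eq_iff] at h
  obtain ⟨δ, h1, h2, h3, h4⟩ := Butterfly.exists_link h
  obtain ⟨d, hd, hd1, hd2⟩ := Butterfly.exists_link_desc D S.ker_mem h1 h3 h4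
  exact ⟨ofB (X := cokerObj D) (Butterfly.cokerDesc D _ d hd1 hd2), Quotient.sound
    (Butterfly.comp_cokerDesc D _ d hd1 hd2 (by rw [hd, h2]))⟩

/-- `kerObj D` is a kernel. -/
def kerIsLimit (D : Cut t P.κ P.ρ) {f : X ⟶ Y} (hf : ofB P = f) (w : kerHom D ≫ f = 0) :
    IsLimit (KernelFork.ofι (kerHom D) w) :=
  KernelFork.IsLimit.ofι' _ _ fun g hg =>
    ⟨(exists_kerLift D g (by rw [hf, hg])).choose,
      (exists_kerLift D g (by rw [hf, hg])).choose_spec⟩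

/-- `cokerObj D` is a cokernel. -/
def cokerIsColimit (D : Cut t P.κ P.ρ) {f : X ⟶ Y} (hf : ofB P = f) (w : f ≫ cokerHom D = 0) :
    IsColimit (CokernelCofork.ofπ (cokerHom D) w) :=
  CokernelCofork.IsColimit.ofπ' _ _ fun g hg =>
    ⟨(exists_cokerDesc D g (by rw [hf, hg])).choose,
      (exists_cokerDesc D g (by rw [hf, hg])).choose_spec⟩

end Tilt

/-! ### Isomorphisms in the tilted category -/

/-- A morphism of two-term complexes that induces isomorphisms on kernels and cokernels. -/
def IsQuasiIso {X Y : Arrow A} (f : X ⟶ Y) : Prop :=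
  IsIso (kernel.map X.hom Y.hom f.left f.right f.w.symm) ∧
    IsIso (cokernel.map X.hom Y.hom f.left f.right f.w.symm)

namespace Butterfly

variable {X Y : Arrow A}

/-- The diagonal X⁻¹ → X⁰ ⊕ Y⁻¹ → Y⁰ is the mapping cone of `f`, and a morphism with acyclic cone is
a quasi-isomorphism. The argument is a direct chase. -/
lemma isQuasiIso_of_shortExact {f : X ⟶ Y}
    (h : (ShortComplex.mk _ _ (ofHom f).κ_ρ).ShortExact) : IsQuasiIso f := by
  have hm : Mono (biprod.lift X.hom (-f.left)) := h.mono_f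
  have he : Epi (biprod.desc f.right Y.hom) := h.epi_g
  constructor
  · have : Mono (kernel.map X.hom Y.hom f.left f.right f.w.symm) := by
      rw [Preadditive.mono_iff_cancel_zero]
      intro T x hx
      rw [← cancel_mono (kernel.ι Y.hom)] at hx
      rw [← cancel_mono (kernel.ι X.hom), zero_comp, ← cancel_mono (biprod.lift X.hom (-f.left))]
      apply biprod.hom_ext <;> simp
      simpa using hx
    have : Epi (kernel.map X.hom Y.hom f.left f.right f.w.symm) := by
      rw [epi_iff_surjective_up_to_refinements]
      intro T y
      have h0 : biprod.lift 0 (y ≫ kernel.ι Y.hom) ≫ biprod.desc f.right Y.hom = 0 := by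
        simp
      obtain ⟨x, hx⟩ : ∃ x, x ≫ biprod.lift X.hom (-f.left) = biprod.lift 0 (y ≫ kernel.ι Y.hom) :=
        ⟨h.exact.lift _ h0, h.exact.lift_f _ h0⟩
      have hx1 : x ≫ X.hom = 0 := by simpa using hx =≫ biprod.fst
      have hx2 : -(x ≫ f.left) = y ≫ kernel.ι Y.hom := by simpa using hx =≫ biprod.snd
      -- The sign compensates the one in `κ = (d, -f⁻¹)`.
      refine ⟨T, 𝟙 _, inferInstance, kernel.lift X.hom (-x) (by simp [hx1]), ?_⟩
      rw [← cancel_mono (kernel.ι Y.hom)]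
      simp [hx2]
    exact isIso_of_mono_of_epi _
  · have : Epi (cokernel.map X.hom Y.hom f.left f.right f.w.symm) := by
      rw [Preadditive.epi_iff_cancel_zero]
      intro T g hg
      rw [← cancel_epi (cokernel.π X.hom)] at hg
      rw [← cancel_epi (cokernel.π Y.hom), comp_zero, ← cancel_epi (biprod.desc f.right Y.hom)]
      apply biprod.hom_ext' <;> simp
      simpa using hg
    have : Mono (cokernel.map X.hom Y.hom f.left f.right f.w.symm) := by
      rw [Preadditive.mono_iff_cancel_zero]
      intro T z hz
      obtain ⟨T', π, _, x, hx⟩ := surjective_up_to_refinements_of_epi (cokernel.π X.hom) z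
      have hx1 : (x ≫ f.right) ≫ cokernel.π Y.hom = 0 := by
        have := π ≫= hz
        rw [reassoc_of% hx] at this
        simpa using this
      obtain ⟨T'', π', _, y, hy⟩ :=
        (ShortComplex.exact_cokernel Y.hom).exact_up_to_refinements _ hx1
      have h0 : biprod.lift (π' ≫ x) (-y) ≫ biprod.desc f.right Y.hom = 0 := by
        dsimp at hy
        simp [biprod.lift_desc, hy]
      have h1 := h.exact.lift_f _ h0 =≫ biprod.fst
      have h2 : h.exact.lift _ h0 ≫ X.hom = π' ≫ x := by simpa using h1
      rw [← cancel_epi π, ← cancel_epi π', hx, ← reassoc_of% h2, cokernel.condition]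
      simp
    exact isIso_of_mono_of_epi _

lemma shortExact_of_isQuasiIso {f : X ⟶ Y} (h : IsQuasiIso f) :
    (ShortComplex.mk _ _ (ofHom f).κ_ρ).ShortExact := by
  obtain ⟨h1, h2⟩ := h
  have hm : Mono (biprod.lift X.hom (-f.left)) := by
    rw [Preadditive.mono_iff_cancel_zero]
    intro T x hx
    have hx1 : x ≫ X.hom = 0 := by simpa using hx =≫ biprod.fst
    have hx2 : x ≫ f.left = 0 := by simpa using hx =≫ biprod.snd
    have h0 : kernel.lift X.hom x hx1 = 0 := by
      rw [← cancel_mono (kernel.map X.hom Y.hom f.left f.right f.w.symm),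
        ← cancel_mono (kernel.ι Y.hom)]
      simp [hx2]
    rw [← kernel.lift_ι X.hom x hx1, h0, zero_comp]
  have he : Epi (biprod.desc f.right Y.hom) := by
    rw [Preadditive.epi_iff_cancel_zero]
    intro T x hx
    have hx1 : f.right ≫ x = 0 := by simpa using biprod.inl ≫= hx
    have hx2 : Y.hom ≫ x = 0 := by simpa using biprod.inr ≫= hx
    have h0 : cokernel.desc Y.hom x hx2 = 0 := by
      rw [← cancel_epi (cokernel.map X.hom Y.hom f.left f.right f.w.symm),
        ← cancel_epi (cokernel.π X.hom)]
      simp [hx1]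
    rw [← cokernel.π_desc Y.hom x hx2, h0, comp_zero]
  refine { mono_f := hm, epi_g := he, exact := ?_ }
  rw [ShortComplex.exact_iff_exact_up_to_refinements]
  intro T z hz
  change T ⟶ X.right ⊞ Y.left at z
  change z ≫ biprod.desc f.right Y.hom = 0 at hz
  obtain ⟨x, hx⟩ : ∃ x, z ≫ biprod.fst = x := ⟨_, rfl⟩
  obtain ⟨y, hy⟩ : ∃ y, z ≫ biprod.snd = y := ⟨_, rfl⟩
  obtain rfl : z = biprod.lift x y := by apply biprod.hom_ext <;> simp [hx, hy]
  rw [biprod.lift_desc] at hz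
  have hx1 : x ≫ cokernel.π X.hom = 0 := by
    rw [← cancel_mono (cokernel.map X.hom Y.hom f.left f.right f.w.symm)]
    have := hz =≫ cokernel.π Y.hom
    simpa using this
  obtain ⟨T', π, hπ, w, hw⟩ := (ShortComplex.exact_cokernel X.hom).exact_up_to_refinements _ hx1
  change π ≫ x = w ≫ X.hom at hw
  have h0 : (π ≫ y + w ≫ f.left) ≫ Y.hom = 0 := by
    have := π ≫= hz
    rw [Preadditive.comp_add, reassoc_of% hw] at this
    rw [Preadditive.add_comp, Category.assoc, Category.assoc, Arrow.w, add_comm, this, comp_zero]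
  -- The error in the second coordinate lies in the kernel of `Y.hom`, hence comes from a unique map
  -- `v` to the kernel of `X.hom`. Subtracting `v` from `w` corrects the second coordinate without
  -- changing the first.
  obtain ⟨v, hv⟩ : ∃ v, v ≫ kernel.ι X.hom ≫ f.left = π ≫ y + w ≫ f.left :=
    ⟨kernel.lift Y.hom _ h0 ≫ inv (kernel.map X.hom Y.hom f.left f.right f.w.symm), by
      have : kernel.ι X.hom ≫ f.left =
        kernel.map X.hom Y.hom f.left f.right f.w.symm ≫ kernel.ι Y.hom := by simp
      rw [this, Category.assoc, IsIso.inv_hom_id_assoc, kernel.lift_ι]⟩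
  refine ⟨T', π, hπ, w - v ≫ kernel.ι X.hom, ?_⟩
  change π ≫ biprod.lift x y = (w - v ≫ kernel.ι X.hom) ≫ biprod.lift X.hom (-f.left)
  apply biprod.hom_ext
  · simp [hw]
  · simp [hv]

/-- An isomorphism between the butterflies of the identity and of zero contains a contraction of the
two-term complex. This shows that the zero objects of B are represented by isomorphisms. -/
lemma isIso_hom_of_id_equiv_zero (h : ofHom (𝟙 X) ≈ ofHom (zeroHom X X)) : IsIso X.hom := by
  obtain ⟨e, h1, h2, h3, h4⟩ := h
  refine ⟨biprod.inl ≫ e.hom ≫ biprod.snd, ?_, ?_⟩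
  -- The right-hand side is κ + ι of the identity butterfly. The isomorphism carries it to κ + ι of
  -- the zero butterfly, whose second component is the identity.
  · have : X.hom ≫ biprod.inl = biprod.lift X.hom (-(𝟙 X : X ⟶ X).left) + biprod.inr := by
      apply biprod.hom_ext <;> simp
    rw [reassoc_of% this, Preadditive.add_comp, reassoc_of% h1, reassoc_of% h2]
    simp [zeroHom]
  · have h5 := biprod.inl ≫= h4
    have h6 : biprod.desc (zeroHom X X).right X.hom = biprod.snd ≫ X.hom := by
      apply biprod.hom_ext' <;> simp [zeroHom]
    rw [Category.assoc, Category.assoc, ← h6]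
    exact h5.trans (by simp)

/-- The butterfly with the two diagonals exchanged. -/
def flip (P : Butterfly X Y) (h : (ShortComplex.mk _ _ P.κ_ρ).ShortExact) : Butterfly Y X where
  E := P.E
  κ := P.ι
  ι := P.κ
  σ := P.ρ
  ρ := P.σ
  κ_σ := P.ι_ρ
  ι_ρ := P.κ_σ
  κ_ρ := P.ι_σ
  ι_σ := P.κ_ρ
  exact := h

/-- Two elements of the middle object with the same image under ρ differ by a unique element of X⁻¹.
This difference `s`, together with σ of the first element, maps the fibre product to X⁰ ⊕ X⁻¹ and
exhibits the identity as the composition. -/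
lemma comp_flip (P : Butterfly X Y) (h : (ShortComplex.mk _ _ P.κ_ρ).ShortExact) :
    comp P (P.flip h) ≈ ofHom (𝟙 X) := by
  have : Mono P.κ := h.mono_f
  obtain ⟨p, hp⟩ : ∃ p, pullback.fst P.ρ (P.flip h).σ = p := ⟨_, rfl⟩
  obtain ⟨q, hq⟩ : ∃ q : _ ⟶ P.E, pullback.snd P.ρ (P.flip h).σ = q := ⟨_, rfl⟩
  have hpq : p ≫ P.ρ = q ≫ P.ρ := by rw [← hp, ← hq]; exact pullback.condition
  have h0 : (q - p) ≫ P.ρ = 0 := by rw [Preadditive.sub_comp, hpq, sub_self]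
  obtain ⟨s, hs⟩ : ∃ s, s ≫ P.κ = q - p := ⟨h.exact.lift _ h0, h.exact.lift_f _ h0⟩
  have r1 : compRel P (P.flip h) ≫ p = P.ι := by rw [← hp]; exact compRel_fst _ _
  have r2 : compRel P (P.flip h) ≫ q = P.ι := by rw [← hq]; exact compRel_snd _ _
  have k1 : compκ P (P.flip h) ≫ p = P.κ := by rw [← hp]; exact compκ_fst _ _
  have k2 : compκ P (P.flip h) ≫ q = 0 := by rw [← hq]; exact compκ_snd _ _
  have i1 : compι P (P.flip h) ≫ p = 0 := by rw [← hp]; exact compι_fst _ _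
  have i2 : compι P (P.flip h) ≫ q = P.κ := by rw [← hq]; exact compι_snd _ _
  refine IsComp.equiv (r := biprod.lift (p ≫ P.σ) s) ⟨?_, ?_, ?_, ?_, ?_⟩
  · apply biprod.hom_ext
    · simp [reassoc_of% r1, P.ι_σ]
    · rw [← cancel_mono P.κ]
      simp [hs, r1, r2]
  · apply biprod.hom_ext
    · simp [reassoc_of% k1, P.κ_σ]
    · rw [← cancel_mono P.κ]
      simp [hs, k1, k2]
  · apply biprod.hom_ext
    · simp [reassoc_of% i1]
    · rw [← cancel_mono P.κ]
      simp only [Category.assoc, biprod.lift_snd, hs, Preadditive.comp_sub, i1, i2, sub_zero]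
      simp
  · rw [hp]
    simp
  · rw [hq]
    have : s ≫ X.hom = q ≫ P.σ - p ≫ P.σ := by
      rw [← P.κ_σ, reassoc_of% hs, Preadditive.sub_comp]
    change biprod.lift (p ≫ P.σ) s ≫ biprod.desc (𝟙 X.right) X.hom = q ≫ P.σ
    exact biprod.lift_desc.trans (by rw [this]; simp)

end Butterfly

namespace Tilt

variable {t : TorsionPair A} {X Y : Tilt t}

lemma isIso_of_id_eq_zero (h : 𝟙 X = 0) : IsIso X.arrow.hom :=
  Butterfly.isIso_hom_of_id_equiv_zero ((ofB_eq_iff _ _).1 h)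

/-- An invertible morphism has zero kernel and cokernel, so both outer maps `D.k` and `D.c` of a cut
are isomorphisms, and the short exact sequence of the cut becomes the diagonal (κ, ρ). Conversely,
the flipped butterfly is an inverse. -/
lemma isIso_ofB_iff (P : Butterfly X.arrow Y.arrow) :
    IsIso (ofB P) ↔ (ShortComplex.mk _ _ P.κ_ρ).ShortExact := by
  constructor
  · intro
    let D : Cut t P.κ P.ρ := Cut.ofZero t P.κ_ρ
    have h1 : kerHom D = 0 := by
      rw [← cancel_mono (ofB P), kerHom_comp, zero_comp]
    have : IsIso D.k := isIso_of_id_eq_zero (X := kerObj D) (by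
      rw [← cancel_mono (kerHom D), h1, comp_zero, comp_zero])
    have h2 : cokerHom D = 0 := by
      rw [← cancel_epi (ofB P), comp_cokerHom, comp_zero]
    have : IsIso D.c := isIso_of_id_eq_zero (X := cokerObj D) (by
      rw [← cancel_epi (cokerHom D), h2, zero_comp, zero_comp])
    exact ShortComplex.shortExact_of_iso
      (ShortComplex.isoMk (asIso D.k).symm (Iso.refl P.E) (asIso D.c)
        (by simp [← cancel_epi D.k, D.k_w]) (by simp [D.p_c])) D.exact
  · intro h
    refine ⟨ofB (P.flip h), Quotient.sound (P.comp_flip h), ?_⟩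
    exact Quotient.sound ((P.flip h).comp_flip P.exact)

/-- A strict morphism is invertible in `B` if and only if it induces isomorphisms on kernels and
cokernels. -/
lemma isIso_strict_iff (f : X.arrow ⟶ Y.arrow) : IsIso (strict f : X ⟶ Y) ↔ IsQuasiIso f := by
  rw [strict, isIso_ofB_iff]
  exact ⟨Butterfly.isQuasiIso_of_shortExact, Butterfly.shortExact_of_isQuasiIso⟩

end Tilt

/-! ### Homology in the tilted category -/

namespace Tilt

variable {t : TorsionPair A}

/-- The data from which the homology of a short complex in `B` is computed: representatives of
the two morphisms, a cut of each, and the two-term complex `m` that represents the homology. -/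
structure HomologyPresentation (S : ShortComplex (Tilt t)) where
  P : Butterfly S.X₁.arrow S.X₂.arrow
  Q : Butterfly S.X₂.arrow S.X₃.arrow
  P_eq : ofB P = S.f
  Q_eq : ofB Q = S.g
  D₁ : Cut t P.κ P.ρ
  D₂ : Cut t Q.κ Q.ρ
  m : D₁.C ⟶ D₂.W
  ι_m : P.ι ≫ D₁.p ≫ m = D₂.k
  m_σ : m ≫ D₂.w ≫ Q.σ = D₁.c

namespace HomologyPresentation

variable {S : ShortComplex (Tilt t)} (R : HomologyPresentation S)

/-- The morphism to the kernel of `S.g` induced by `S.f`. -/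
def toKer : Butterfly S.X₁.arrow (kerObj R.D₂).arrow :=
  Butterfly.kerLift R.D₂ R.P (R.D₁.p ≫ R.m) (by rw [reassoc_of% R.D₁.a_p, zero_comp]) R.ι_m

/-- The morphism from the cokernel of `S.f` induced by `S.g`. -/
def fromCoker : Butterfly (cokerObj R.D₁).arrow S.X₃.arrow :=
  Butterfly.cokerDesc R.D₁ R.Q (R.m ≫ R.D₂.w) (by rw [Category.assoc, R.m_σ])
    (by rw [Category.assoc, R.D₂.w_b, comp_zero])

lemma toKer_comp : ofB R.toKer ≫ kerHom R.D₂ = S.f :=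
  (Quotient.sound (Butterfly.kerLift_comp R.D₂ R.P (R.D₁.p ≫ R.m) _ R.ι_m (by
    rw [Category.assoc, R.m_σ, R.D₁.p_c]))).trans R.P_eq

lemma comp_fromCoker : cokerHom R.D₁ ≫ ofB R.fromCoker = S.g :=
  (Quotient.sound (Butterfly.comp_cokerDesc R.D₁ R.Q (R.m ≫ R.D₂.w) _ _ (by
    rw [reassoc_of% R.ι_m, R.D₂.k_w]))).trans R.Q_eq

/-- The cut of `R.toKer` induced by `R.D₁`. -/
def cutToKer : Cut t R.toKer.κ R.toKer.ρ where
  W := R.D₁.W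
  C := R.D₁.C
  k := R.D₁.k
  w := R.D₁.w
  p := R.D₁.p
  c := R.m
  w_p := R.D₁.w_p
  exact := R.D₁.exact
  k_w := R.D₁.k_w
  p_c := rfl
  T_mem := R.D₁.T_mem
  F_mem := t.F_kernel_of_comp R.m_σ R.D₁.F_mem

/-- The cut of `R.fromCoker` induced by `R.D₂`. -/
def cutFromCoker : Cut t R.fromCoker.κ R.fromCoker.ρ where
  W := R.D₂.W
  C := R.D₂.C
  k := R.m
  w := R.D₂.w
  p := R.D₂.p
  c := R.D₂.c
  w_p := R.D₂.w_p
  exact := R.D₂.exact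
  k_w := rfl
  p_c := R.D₂.p_c
  T_mem := t.T_cokernel_of_comp (f := R.P.ι ≫ R.D₁.p) (by rw [Category.assoc, R.ι_m]) R.D₂.T_mem
  F_mem := R.D₂.F_mem

lemma kerHom_comp : kerHom R.D₂ ≫ S.g = 0 := by rw [← R.Q_eq, Tilt.kerHom_comp]

lemma comp_cokerHom : S.f ≫ cokerHom R.D₁ = 0 := by rw [← R.P_eq, Tilt.comp_cokerHom]

/-- Homology data are phrased with the abstract lift to the kernel. This identifies that lift with
an explicit butterfly, whose cut is known. -/
lemma lift_eq : ofB R.toKer =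
    (kerIsLimit R.D₂ R.Q_eq R.kerHom_comp).lift (KernelFork.ofι S.f S.zero) := by
  rw [← cancel_mono (kerHom R.D₂), toKer_comp]
  exact ((kerIsLimit R.D₂ R.Q_eq R.kerHom_comp).fac (KernelFork.ofι S.f S.zero)
    WalkingParallelPair.zero).symm

lemma desc_eq : ofB R.fromCoker =
    (cokerIsColimit R.D₁ R.P_eq R.comp_cokerHom).desc (CokernelCofork.ofπ S.g S.zero) := by
  rw [← cancel_epi (cokerHom R.D₁), comp_fromCoker]
  exact ((cokerIsColimit R.D₁ R.P_eq R.comp_cokerHom).fac (CokernelCofork.ofπ S.g S.zero)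
    WalkingParallelPair.one).symm

/-- The left homology data given by the kernel of `S.g` and the cokernel of the induced map. -/
def leftHomologyData : S.LeftHomologyData where
  K := kerObj R.D₂
  H := cokerObj R.cutToKer
  i := kerHom R.D₂
  π := cokerHom R.cutToKer
  wi := R.kerHom_comp
  hi := kerIsLimit R.D₂ R.Q_eq R.kerHom_comp
  wπ := by rw [← lift_eq, Tilt.comp_cokerHom]
  hπ := cokerIsColimit R.cutToKer R.lift_eq _

/-- The right homology data given by the cokernel of `S.f` and the kernel of the induced map. -/
def rightHomologyData : S.RightHomologyData where
  Q := cokerObj R.D₁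
  H := kerObj R.cutFromCoker
  p := cokerHom R.D₁
  ι := kerHom R.cutFromCoker
  wp := R.comp_cokerHom
  hp := cokerIsColimit R.D₁ R.P_eq R.comp_cokerHom
  wι := by rw [← desc_eq, Tilt.kerHom_comp]
  hι := kerIsLimit R.cutFromCoker R.desc_eq _

/-- The homology data of a presentation. -/
def homologyData : S.HomologyData where
  left := R.leftHomologyData
  right := R.rightHomologyData
  -- The left and the right homology are literally the same two-term complex `R.m`, so only the
  -- compatibility of the structure maps is left. All of these are strict.
  iso := Iso.refl _
  comm := by
    have h : Butterfly.cokerπ R.cutToKer ≫ Butterfly.kerι R.cutFromCoker =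
        Butterfly.kerι R.D₂ ≫ Butterfly.cokerπ R.D₁ := by
      ext
      · exact (Category.comp_id _).trans (Category.id_comp _).symm
      · exact (Category.id_comp _).trans (Category.comp_id _).symm
    refine Eq.trans (congrArg (cokerHom R.cutToKer ≫ ·)
      (Category.id_comp (X := cokerObj R.cutToKer) (kerHom R.cutFromCoker))) ?_
    refine (strict_comp (X := kerObj R.D₂) (Y := cokerObj R.cutToKer) (Z := cokerObj R.D₁)
      _ _).symm.trans (Eq.trans ?_ (strict_comp (X := kerObj R.D₂) (Y := S.X₂)
      (Z := cokerObj R.D₁) _ _))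
    exact congrArg strict h

lemma hasHomology (R : HomologyPresentation S) : S.HasHomology := ⟨⟨R.homologyData⟩⟩

variable {R} {S' : ShortComplex (Tilt t)} {R' : HomologyPresentation S'} {φ : S ⟶ S'}

/-- The inclusion of the kernel and the projection to the homology are strict, so a strict morphism
in the middle induces a strict morphism on homology. Its invertibility is then decided by
`isIso_strict_iff`. -/
lemma quasiIso_iff [S.HasHomology] [S'.HasHomology] {f : S.X₂.arrow ⟶ S'.X₂.arrow}
    (hf : φ.τ₂ = strict f) {g₁ : R.D₁.C ⟶ R'.D₁.C} {g₂ : R.D₂.W ⟶ R'.D₂.W}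
    (comm : g₁ ≫ R'.m = R.m ≫ g₂)
    (hg₁ : (R.P.ι ≫ R.D₁.p) ≫ g₁ = f.left ≫ R'.P.ι ≫ R'.D₁.p)
    (hg₂ : R.D₂.k ≫ g₂ = f.left ≫ R'.D₂.k)
    (hg₂' : g₂ ≫ R'.D₂.w ≫ R'.Q.σ = (R.D₂.w ≫ R.Q.σ) ≫ f.right) :
    ShortComplex.QuasiIso φ ↔
      IsQuasiIso (Arrow.homMk g₁ g₂ comm : Arrow.mk R.m ⟶ Arrow.mk R'.m) := by
  let fK : (kerObj R.D₂).arrow ⟶ (kerObj R'.D₂).arrow := Arrow.homMk f.left g₂ hg₂.symm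
  let fH : (cokerObj R.cutToKer).arrow ⟶ (cokerObj R'.cutToKer).arrow := Arrow.homMk g₁ g₂ comm
  have hi : fK ≫ Butterfly.kerι R'.D₂ = Butterfly.kerι R.D₂ ≫ f := by
    ext
    · exact (Category.comp_id _).trans (Category.id_comp _).symm
    · exact hg₂'
  have hπ : Butterfly.cokerπ R.cutToKer ≫ fH = fK ≫ Butterfly.cokerπ R'.cutToKer := by
    ext
    · exact hg₁
    · exact (Category.id_comp _).trans (Category.comp_id _).symm
  have hi' : strict fK ≫ kerHom R'.D₂ = kerHom R.D₂ ≫ φ.τ₂ := by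
    rw [hf]
    exact (strict_comp (X := kerObj R.D₂) (Y := kerObj R'.D₂) (Z := S'.X₂) _ _).symm.trans
      ((congrArg strict hi).trans (strict_comp (X := kerObj R.D₂) (Y := S.X₂) (Z := S'.X₂) _ _))
  have hπ' : cokerHom R.cutToKer ≫ strict fH = strict fK ≫ cokerHom R'.cutToKer :=
    (strict_comp (X := kerObj R.D₂) (Y := cokerObj R.cutToKer) (Z := cokerObj R'.cutToKer)
      _ _).symm.trans ((congrArg strict hπ).trans
      (strict_comp (X := kerObj R.D₂) (Y := kerObj R'.D₂) (Z := cokerObj R'.cutToKer) _ _))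
  let γ : ShortComplex.LeftHomologyMapData φ R.leftHomologyData R'.leftHomologyData :=
    { φK := strict fK
      φH := strict fH
      commi := hi'
      -- This follows from `commi`, since the inclusion of the target kernel is a monomorphism.
      commf' := by
        rw [← cancel_mono R'.leftHomologyData.i, Category.assoc, Category.assoc,
          R'.leftHomologyData.f'_i, φ.comm₁₂, ← R.leftHomologyData.f'_i, Category.assoc]
        exact _ ≫= hi'
      commπ := hπ' }
  rw [γ.quasiIso_iff]
  exact isIso_strict_iff fH

end HomologyPresentation

end Tilt

/-! ### The torsion filtration of cohomology -/

/-- The inverse of the middle map respects the filtrations as well, because the only obstruction is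
a morphism from `S'.X₁`, which is torsion, to `S.X₃`, which is torsion-free. The converse is the
short five lemma. -/
lemma TorsionPair.isIso₂_iff (t : TorsionPair A) {S S' : ShortComplex A} (φ : S ⟶ S')
    (hS : S.ShortExact) (hS' : S'.ShortExact) (h₁ : t.T S'.X₁) (h₃ : t.F S.X₃) :
    IsIso φ.τ₂ ↔ IsIso φ.τ₁ ∧ IsIso φ.τ₃ := by
  have := hS.mono_f
  have := hS'.mono_f
  have := hS.epi_g
  have := hS'.epi_g
  constructor
  · intro
    have h0 : (S'.f ≫ inv φ.τ₂) ≫ S.g = 0 := t.hom_eq_zero h₁ h₃ _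
    constructor
    · obtain ⟨s, hs⟩ : ∃ s, s ≫ S.f = S'.f ≫ inv φ.τ₂ :=
        ⟨hS.exact.lift _ h0, hS.exact.lift_f _ h0⟩
      refine ⟨s, ?_, ?_⟩
      · rw [← cancel_mono S.f, Category.assoc, hs, ← Category.assoc, φ.comm₁₂]
        simp
      · rw [← cancel_mono S'.f, Category.assoc, φ.comm₁₂, reassoc_of% hs]
        simp
    · rw [Category.assoc] at h0
      obtain ⟨s, hs⟩ : ∃ s, S'.g ≫ s = inv φ.τ₂ ≫ S.g :=
        ⟨hS'.exact.desc _ h0, hS'.exact.g_desc _ h0⟩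
      refine ⟨s, ?_, ?_⟩
      · rw [← cancel_epi S.g, ← Category.assoc, ← φ.comm₂₃, Category.assoc, hs]
        simp
      · rw [← cancel_epi S'.g, reassoc_of% hs, ← φ.comm₂₃]
        simp
  · rintro ⟨_, _⟩
    exact ShortComplex.isIso₂_of_shortExact_of_isIso₁₃ φ hS hS'

/-- A factorization of a short complex through a short exact sequence `W ⟶ S.X₂ ⟶ C`, which
filters the homology of `S` by the cokernel of `l` and the kernel of `r`. -/
structure HomologyCut (S : ShortComplex A) where
  {U W C V : A}
  e : S.X₁ ⟶ U
  l : U ⟶ W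
  w : W ⟶ S.X₂
  p : S.X₂ ⟶ C
  r : C ⟶ V
  m : V ⟶ S.X₃
  epi_e : Epi e
  mono_m : Mono m
  w_p : w ≫ p = 0
  exact : (ShortComplex.mk w p w_p).ShortExact
  e_l_w : e ≫ l ≫ w = S.f
  p_r_m : p ≫ r ≫ m = S.g

namespace HomologyCut

attribute [instance] epi_e mono_m

section

variable {S : ShortComplex A} (D : HomologyCut S)

instance : Mono D.w := D.exact.mono_f

instance : Epi D.p := D.exact.epi_g

lemma w_g : D.w ≫ S.g = 0 := by rw [← D.p_r_m, reassoc_of% D.w_p, zero_comp]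

lemma f_p : S.f ≫ D.p = 0 := by
  rw [← D.e_l_w, Category.assoc, Category.assoc, D.w_p, comp_zero, comp_zero]

/-- The map from the cokernel of `l` to the homology. -/
def incl : cokernel D.l ⟶ S.homology :=
  cokernel.desc D.l (S.liftCycles D.w D.w_g ≫ S.homologyπ) (by
    have : D.e ≫ D.l ≫ S.liftCycles D.w D.w_g = S.toCycles := by
      rw [← cancel_mono S.iCycles]
      simp [D.e_l_w]
    rw [← cancel_epi D.e, reassoc_of% this, S.toCycles_comp_homologyπ, comp_zero])

/-- The map from the homology to the kernel of `r`. -/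
def proj : S.homology ⟶ kernel D.r :=
  kernel.lift D.r (S.homologyι ≫ S.descOpcycles D.p D.f_p) (by
    have : S.descOpcycles D.p D.f_p ≫ D.r ≫ D.m = S.fromOpcycles := by
      rw [← cancel_epi S.pOpcycles]
      simp [D.p_r_m]
    rw [← cancel_mono D.m, Category.assoc, Category.assoc, this, S.homologyι_comp_fromOpcycles,
      zero_comp])

lemma π_incl : cokernel.π D.l ≫ D.incl = S.liftCycles D.w D.w_g ≫ S.homologyπ := by simp [incl]

lemma proj_ι : D.proj ≫ kernel.ι D.r = S.homologyι ≫ S.descOpcycles D.p D.f_p := by simp [proj]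

lemma homologyπ_proj_ι : S.homologyπ ≫ D.proj ≫ kernel.ι D.r = S.iCycles ≫ D.p := by
  rw [proj_ι, S.homology_π_ι_assoc, S.p_descOpcycles]

lemma incl_proj : D.incl ≫ D.proj = 0 := by
  rw [← cancel_epi (cokernel.π D.l), ← cancel_mono (kernel.ι D.r), Category.assoc,
    Category.assoc, reassoc_of% D.π_incl, homologyπ_proj_ι, S.liftCycles_i_assoc, D.w_p]
  simp

/-- W lies between im f and ker g. As `e` is epi and `w` is mono, W / im f is coker l. As `m` is
mono, ker g / W is ker r. -/
lemma shortExact : (ShortComplex.mk D.incl D.proj D.incl_proj).ShortExact := by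
  have hm : Mono D.incl := by
    rw [Preadditive.mono_iff_cancel_zero]
    intro T x hx
    obtain ⟨T', π, _, y, hy⟩ := surjective_up_to_refinements_of_epi (cokernel.π D.l) x
    have h0 : (y ≫ S.liftCycles D.w D.w_g) ≫ S.homologyπ = 0 := by
      rw [Category.assoc, ← π_incl, ← reassoc_of% hy, hx, comp_zero]
    rw [S.comp_homologyπ_eq_zero_iff_up_to_refinements] at h0
    obtain ⟨T'', π', _, z, hz⟩ := h0
    have h1 : π' ≫ y = (z ≫ D.e) ≫ D.l := by
      have := hz =≫ S.iCycles
      rw [← cancel_mono D.w]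
      simpa [← D.e_l_w] using this
    rw [← cancel_epi π, ← cancel_epi π', hy, reassoc_of% h1, cokernel.condition]
    simp
  have he : Epi D.proj := by
    rw [epi_iff_surjective_up_to_refinements]
    intro T x
    obtain ⟨T', π, hπ, y, hy⟩ := surjective_up_to_refinements_of_epi D.p (x ≫ kernel.ι D.r)
    have h0 : y ≫ S.g = 0 := by
      rw [← D.p_r_m, ← reassoc_of% hy, kernel.condition_assoc, zero_comp, comp_zero, comp_zero]
    refine ⟨T', π, hπ, S.liftCycles y h0 ≫ S.homologyπ, ?_⟩
    rw [← cancel_mono (kernel.ι D.r), Category.assoc, hy, Category.assoc, Category.assoc,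
      homologyπ_proj_ι, S.liftCycles_i_assoc]
  refine { mono_f := hm, epi_g := he, exact := ?_ }
  rw [ShortComplex.exact_iff_exact_up_to_refinements]
  intro T γ hγ
  change T ⟶ S.homology at γ
  change γ ≫ D.proj = 0 at hγ
  obtain ⟨T', π, hπ, z, hz, hγz⟩ := S.eq_liftCycles_homologyπ_up_to_refinements γ
  have h0 : z ≫ D.p = 0 := by
    rw [← S.liftCycles_i z hz, Category.assoc, ← homologyπ_proj_ι, ← reassoc_of% hγz,
      reassoc_of% hγ, zero_comp, comp_zero]
  obtain ⟨y, hy⟩ : ∃ y, y ≫ D.w = z := ⟨D.exact.exact.lift _ h0, D.exact.exact.lift_f _ h0⟩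
  refine ⟨T', π, hπ, y ≫ cokernel.π D.l, ?_⟩
  change π ≫ γ = (y ≫ cokernel.π D.l) ≫ D.incl
  have h1 : S.liftCycles z hz = y ≫ S.liftCycles D.w D.w_g := by
    rw [← cancel_mono S.iCycles]
    simp [hy]
  rw [Category.assoc, π_incl, hγz, h1, Category.assoc]

end

variable {S S' : ShortComplex A} {φ : S ⟶ S'} (D : HomologyCut S) (D' : HomologyCut S')
  {gU : D.U ⟶ D'.U} {gW : D.W ⟶ D'.W} {gC : D.C ⟶ D'.C} {gV : D.V ⟶ D'.V}

/-- The map on homology is the middle term of a morphism between the extensions of `shortExact`, so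
`TorsionPair.isIso₂_iff` applies. -/
lemma quasiIso_iff (t : TorsionPair A) (hT : t.T (cokernel D'.l)) (hF : t.F (kernel D.r))
    (hw : gW ≫ D'.w = D.w ≫ φ.τ₂) (hp : D.p ≫ gC = φ.τ₂ ≫ D'.p)
    (hl : D.l ≫ gW = gU ≫ D'.l) (hr : D.r ≫ gV = gC ≫ D'.r) :
    ShortComplex.QuasiIso φ ↔
      IsIso (cokernel.map D.l D'.l gU gW hl) ∧ IsIso (kernel.map D.r D'.r gC gV hr) := by
  let Φ : ShortComplex.mk D.incl D.proj D.incl_proj ⟶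
      ShortComplex.mk D'.incl D'.proj D'.incl_proj :=
    { τ₁ := cokernel.map D.l D'.l gU gW hl
      τ₂ := ShortComplex.homologyMap φ
      τ₃ := kernel.map D.r D'.r gC gV hr
      comm₁₂ := by
        have : gW ≫ S'.liftCycles D'.w D'.w_g =
            S.liftCycles D.w D.w_g ≫ ShortComplex.cyclesMap φ := by
          rw [← cancel_mono S'.iCycles]
          simp [hw]
        rw [← cancel_epi (cokernel.π D.l)]
        simp only [cokernel.π_desc_assoc, Category.assoc]
        rw [π_incl, reassoc_of% this, reassoc_of% D.π_incl]
        simp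
      comm₂₃ := by
        have : S.descOpcycles D.p D.f_p ≫ gC =
            ShortComplex.opcyclesMap φ ≫ S'.descOpcycles D'.p D'.f_p := by
          rw [← cancel_epi S.pOpcycles]
          simp [hp]
        rw [← cancel_mono (kernel.ι D'.r)]
        simp only [kernel.lift_ι, Category.assoc]
        rw [proj_ι, reassoc_of% D.proj_ι, this]
        simp }
  rw [ShortComplex.quasiIso_iff]
  exact t.isIso₂_iff Φ D.shortExact D'.shortExact hT hF

end HomologyCut

/-! ### Quasi-isomorphisms -/

namespace Tot

variable {t : TorsionPair A}

/-- A cut of the middle object `E n`. -/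
def cut (X : ChSt t) (n : ℤ) : Cut t (rep X n).κ (rep X n).ρ := Cut.ofZero t (rep X n).κ_ρ

/-- The link vanishes on W^n and lands in W^{n+1}, by the two halves of the torsion argument for
kernels and cokernels in B. -/
lemma exists_mid (X : ChSt t) (n : ℤ) : ∃ m : (cut X n).C ⟶ (cut X (n + 1)).W,
    (cut X n).p ≫ m ≫ (cut X (n + 1)).w = δ X n := by
  obtain ⟨d, hd, -⟩ := Butterfly.exists_link_lift (cut X (n + 1)) (X.cx.X n).coker_mem
    (κ_δ X n) (ι_δ X n) (δ_ρ X n)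
  obtain ⟨d', hd', -⟩ := Butterfly.exists_link_desc (cut X n) (X.cx.X _).ker_mem
    (κ_δ X n) (δ_σ X n) (δ_ρ X n)
  obtain ⟨m, hm⟩ := (cut X n).exists_desc d (by
    rw [← cancel_mono (cut X (n + 1)).w, Category.assoc, hd, ← hd', reassoc_of% (cut X n).w_p,
      zero_comp, zero_comp])
  exact ⟨m, by rw [reassoc_of% hm, hd]⟩

/-- The two-term complex representing the cohomology in degree `n + 1` of a complex in `B`. -/
def mid (X : ChSt t) (n : ℤ) : (cut X n).C ⟶ (cut X (n + 1)).W := (exists_mid X n).choose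

lemma p_mid_w (X : ChSt t) (n : ℤ) : (cut X n).p ≫ mid X n ≫ (cut X (n + 1)).w = δ X n :=
  (exists_mid X n).choose_spec

lemma ι_p_mid (X : ChSt t) (n : ℤ) : (rep X n).ι ≫ (cut X n).p ≫ mid X n = (cut X (n + 1)).k := by
  rw [← cancel_mono (cut X (n + 1)).w, Category.assoc, Category.assoc, p_mid_w,
    (cut X (n + 1)).k_w, ι_δ]

lemma mid_w_σ (X : ChSt t) (n : ℤ) :
    mid X n ≫ (cut X (n + 1)).w ≫ (rep X (n + 1)).σ = (cut X n).c := by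
  rw [← cancel_epi (cut X n).p, (cut X n).p_c, reassoc_of% p_mid_w, δ_σ]

/-- The presentation of the cohomology in degree `n + 1` of a complex in `B`. -/
def presentation (X : ChSt t) (n : ℤ) :
    Tilt.HomologyPresentation (X.cx.sc' n (n + 1) (n + 1 + 1)) where
  P := rep X n
  Q := rep X (n + 1)
  P_eq := Tilt.ofB_out _
  Q_eq := Tilt.ofB_out _
  D₁ := cut X n
  D₂ := cut X (n + 1)
  m := mid X n
  ι_m := ι_p_mid X n
  m_σ := mid_w_σ X n

/-- The factorization of the complex `Tot X` through the cuts. -/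
def homologyCut (X : ChSt t) (n : ℤ) :
    HomologyCut ((auxObj X).cx.sc' n (n + 1) (n + 1 + 1)) where
  U := (cut X n).C
  W := (cut X (n + 1)).W
  C := (cut X (n + 1)).C
  V := (cut X (n + 1 + 1)).W
  e := (cut X n).p
  l := mid X n
  w := (cut X (n + 1)).w
  p := (cut X (n + 1)).p
  r := mid X (n + 1)
  m := (cut X (n + 1 + 1)).w
  epi_e := inferInstanceAs (Epi (cut X n).p)
  mono_m := inferInstanceAs (Mono (cut X (n + 1 + 1)).w)
  w_p := (cut X (n + 1)).w_p
  exact := (cut X (n + 1)).exact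
  e_l_w := (p_mid_w X n).trans (auxObj_d X n).symm
  p_r_m := (p_mid_w X (n + 1)).trans (auxObj_d X (n + 1)).symm

/-! ### Maps induced on cuts and on cohomology by a strict morphism of complexes -/

section

variable {X Y : ChSt t} (φ : X ⟶ Y) (n : ℤ)

lemma exists_cutMap : ∃ (f : (cut X n).W ⟶ (cut Y n).W) (g : (cut X n).C ⟶ (cut Y n).C),
    f ≫ (cut Y n).w = (cut X n).w ≫ map φ n ∧ (cut X n).p ≫ g = map φ n ≫ (cut Y n).p ∧
      (cut X n).k ≫ f = (ChSt.Hom.f φ n).left ≫ (cut Y n).k ∧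
      g ≫ (cut Y n).c = (cut X n).c ≫ (ChSt.Hom.f φ (n + 1)).right :=
  (cut X n).exists_map (cut Y n) (κ_map φ n) (map_ρ φ n)

/-- The map induced on the subobjects of the cuts. -/
def mapW : (cut X n).W ⟶ (cut Y n).W := (exists_cutMap φ n).choose

/-- The map induced on the quotients of the cuts. -/
def mapC : (cut X n).C ⟶ (cut Y n).C := (exists_cutMap φ n).choose_spec.choose

lemma mapW_w : mapW φ n ≫ (cut Y n).w = (cut X n).w ≫ map φ n :=
  (exists_cutMap φ n).choose_spec.choose_spec.1

lemma p_mapC : (cut X n).p ≫ mapC φ n = map φ n ≫ (cut Y n).p :=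
  (exists_cutMap φ n).choose_spec.choose_spec.2.1

lemma k_mapW : (cut X n).k ≫ mapW φ n = (ChSt.Hom.f φ n).left ≫ (cut Y n).k :=
  (exists_cutMap φ n).choose_spec.choose_spec.2.2.1

lemma mapC_mid : mapC φ n ≫ mid Y n = mid X n ≫ mapW φ (n + 1) := by
  rw [← cancel_epi (cut X n).p, ← cancel_mono (cut Y (n + 1)).w]
  simp only [Category.assoc]
  rw [reassoc_of% p_mapC, p_mid_w, mapW_w, reassoc_of% p_mid_w, map_δ]

/-- The map induced on the cohomology in degree `n + 1`. -/
def midMap : Arrow.mk (mid X n) ⟶ Arrow.mk (mid Y n) :=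
  Arrow.homMk (mapC φ n) (mapW φ (n + 1)) (mapC_mid φ n)

lemma quasiIso_sc'_iff [(((ChSt.toCh t).obj X).sc' n (n + 1) (n + 1 + 1)).HasHomology]
    [(((ChSt.toCh t).obj Y).sc' n (n + 1) (n + 1 + 1)).HasHomology] :
    ShortComplex.QuasiIso (S₁ := ((ChSt.toCh t).obj X).sc' n (n + 1) (n + 1 + 1))
      (S₂ := ((ChSt.toCh t).obj Y).sc' n (n + 1) (n + 1 + 1))
      ((HomologicalComplex.shortComplexFunctor' (Tilt t) _ n (n + 1) (n + 1 + 1)).map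
        ((ChSt.toCh t).map φ)) ↔ IsQuasiIso (midMap φ n) :=
  Tilt.HomologyPresentation.quasiIso_iff (S := ((ChSt.toCh t).obj X).sc' n (n + 1) (n + 1 + 1))
    (S' := ((ChSt.toCh t).obj Y).sc' n (n + 1) (n + 1 + 1))
    (R := presentation X n) (R' := presentation Y n)
    (f := ChSt.Hom.f φ (n + 1)) rfl (mapC_mid φ n)
    (by
      change ((rep X n).ι ≫ (cut X n).p) ≫ mapC φ n = _ ≫ (rep Y n).ι ≫ (cut Y n).p
      rw [Category.assoc, p_mapC, reassoc_of% ι_map])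
    (k_mapW φ (n + 1))
    (by
      change mapW φ (n + 1) ≫ (cut Y (n + 1)).w ≫ (rep Y (n + 1)).σ =
        ((cut X (n + 1)).w ≫ (rep X (n + 1)).σ) ≫ _
      rw [reassoc_of% mapW_w, map_σ, Category.assoc])

/-- The torsion part of the cohomology in degree n + 1 is the cokernel of `mid` at n, and the
torsion-free part is the kernel of `mid` at n + 1. A single degree in A therefore sees halves of two
neighbouring cohomology objects of B. -/
lemma quasiIsoAt_aux_iff :
    QuasiIsoAt (Dec.Hom.φ ((aux t).map φ)) (n + 1) ↔
      IsIso (cokernel.map _ _ (mapC φ n) (mapW φ (n + 1)) (mapC_mid φ n).symm) ∧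
        IsIso (kernel.map _ _ (mapC φ (n + 1)) (mapW φ (n + 1 + 1))
          (mapC_mid φ (n + 1)).symm) := by
  rw [quasiIsoAt_iff' _ n (n + 1) (n + 1 + 1) (by simp) (by simp)]
  exact HomologyCut.quasiIso_iff (homologyCut X n) (homologyCut Y n) t
    (presentation Y n).cutFromCoker.T_mem (presentation X (n + 1)).cutToKer.F_mem
    (mapW_w φ (n + 1)) (p_mapC φ (n + 1)) _ _

end

lemma hasHomology_sc' (X : ChSt t) (n : ℤ) : (X.cx.sc' n (n + 1) (n + 1 + 1)).HasHomology :=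
  (presentation X n).hasHomology

lemma hasHomology (X : ChSt t) (n : ℤ) : X.cx.HasHomology (n + 1) := by
  have := hasHomology_sc' X n
  exact ShortComplex.hasHomology_of_iso
    (X.cx.isoSc' n (n + 1) (n + 1 + 1) (by simp) (by simp)).symm

/-- Cohomology is computed in degrees written as n + 1, where links and cuts compose without
transport. This loses no degree. -/
lemma forall_int_iff_forall_add_one {p : ℤ → Prop} : (∀ n, p n) ↔ ∀ n, p (n + 1) :=
  ⟨fun h n => h _, fun h n => by simpa using h (n - 1)⟩

lemma qis_iff {X Y : ChSt t} (φ : X ⟶ Y) :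
    ChSt.qis t φ ↔ ∀ n, IsQuasiIso (midMap φ n) := by
  rw [ChSt.qis, forall_int_iff_forall_add_one]
  refine forall_congr' fun n => ?_
  have hX : ((ChSt.toCh t).obj X).HasHomology (n + 1) := hasHomology X n
  have hY : ((ChSt.toCh t).obj Y).HasHomology (n + 1) := hasHomology Y n
  have : (((ChSt.toCh t).obj X).sc' n (n + 1) (n + 1 + 1)).HasHomology := hasHomology_sc' X n
  have : (((ChSt.toCh t).obj Y).sc' n (n + 1) (n + 1 + 1)).HasHomology := hasHomology_sc' Y n
  refine Iff.trans ?_ ((quasiIsoAt_iff' ((ChSt.toCh t).map φ) n (n + 1) (n + 1 + 1) (by simp)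
    (by simp)).trans (quasiIso_sc'_iff φ n))
  -- Existence of cohomology is part of the definition of `ChSt.qis`, and it always holds.
  exact ⟨fun ⟨_, _, h⟩ => h, fun h => ⟨hX, hY, h⟩⟩

/-- Once all degrees are quantified over, the shift between the kernel and cokernel conditions of
`quasiIsoAt_aux_iff` disappears. -/
lemma quasiIso_aux_iff {X Y : ChSt t} (φ : X ⟶ Y) :
    QuasiIso (Dec.Hom.φ ((aux t).map φ)) ↔ ∀ n, IsQuasiIso (midMap φ n) := by
  rw [quasiIso_iff, forall_int_iff_forall_add_one]
  simp only [quasiIsoAt_aux_iff, IsQuasiIso, forall_and]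
  rw [and_comm]
  exact and_congr_left' (forall_int_iff_forall_add_one
    (p := fun n => IsIso (kernel.map (mid X n) (mid Y n) (mapC φ n) (mapW φ (n + 1))
      (mapC_mid φ n).symm))).symm

lemma quasiIso_reindex_iff {E F : Dec A} (α : E ⟶ F) :
    QuasiIso (Dec.Hom.φ (Dec.reindex.map α)) ↔ QuasiIso (Dec.Hom.φ α) := by
  have key (m : ℤ) : QuasiIsoAt (Dec.Hom.φ (Dec.reindex.map α)) m ↔
      QuasiIsoAt (Dec.Hom.φ α) (m - 1) := by
    rw [quasiIsoAt_iff' _ (m - 1) m (m + 1) (by simp) (by simp),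
      quasiIsoAt_iff' _ (m - 1 - 1) (m - 1) (m + 1 - 1) (by simp) (by simp)]
    -- With the neighbouring degrees written this way, the two short complexes coincide
    -- definitionally.
    rfl
  rw [quasiIso_iff, quasiIso_iff]
  refine ⟨fun h n => ?_, fun h n => (key n).2 (h _)⟩
  have := (key (n + 1)).1 (h _)
  rwa [add_sub_cancel_right] at this

lemma qis_map_iff {X Y : ChSt t} (φ : X ⟶ Y) :
    ChDec.qis t ((Tot t).map φ) ↔ ChSt.qis t φ := by
  rw [qis_iff, ← quasiIso_aux_iff, ← quasiIso_reindex_iff]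
  rfl

end Tot

/-! ### Strict isomorphisms -/

lemma isQuasiIso_iff_of_iso {X Y X' Y' : Arrow A} {f : X ⟶ Y} {f' : X' ⟶ Y'} (a : X ≅ X')
    (b : Y ≅ Y') (h : f ≫ b.hom = a.hom ≫ f') : IsQuasiIso f ↔ IsQuasiIso f' := by
  have key (F : Arrow A ⥤ A) : IsIso (F.map f) ↔ IsIso (F.map f') :=
    (MorphismProperty.isomorphisms A).arrow_mk_iso_iff
      (Arrow.isoMk (F.mapIso a) (F.mapIso b) (by
        change F.map a.hom ≫ F.map f' = F.map f ≫ F.map b.hom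
        rw [← F.map_comp, ← F.map_comp, h]))
  exact and_congr (key (ker A)) (key (coker A))

namespace Dec

/-- The map `M i ⟶ E j / M j` induced by the differential, as a functor to two-term complexes. -/
def dbarFunctor (i j : ℤ) : Dec A ⥤ Arrow A where
  obj E := Arrow.mk (E.dbar i j)
  map α := Arrow.homMk (mapM α i) (mapQ α j) (dbar_comm α i j).symm
  map_id E := by
    ext
    · change mapM (𝟙 E) i = 𝟙 _
      rw [← cancel_mono (E.M i).arrow, mapM_arrow, Category.id_comp]
      exact Category.comp_id _
    · change mapQ (𝟙 E) j = 𝟙 _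
      rw [← cancel_epi (cokernel.π _), mapQ, cokernel.π_desc, Category.comp_id]
      exact Category.id_comp _
  map_comp {E F G} α β := by
    ext
    · change mapM (α ≫ β) i = mapM α i ≫ mapM β i
      rw [← cancel_mono (G.M i).arrow, mapM_arrow, Category.assoc, mapM_arrow, ← Category.assoc,
        mapM_arrow, Category.assoc]
      rfl
    · change mapQ (α ≫ β) j = mapQ α j ≫ mapQ β j
      rw [← cancel_epi (cokernel.π _), mapQ, mapQ, mapQ, cokernel.π_desc, cokernel.π_desc_assoc,
        Category.assoc, cokernel.π_desc, ← Category.assoc]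
      rfl

/-- The underlying complex. -/
def forget : Dec A ⥤ CochainComplex A ℤ where
  obj E := E.cx
  map α := Hom.φ α

end Dec

namespace ChDec

variable (t : TorsionPair A)

lemma sis_iff {E F : ChDec t} (α : E ⟶ F) :
    sis t α ↔ ∀ n : ℤ, IsQuasiIso ((Dec.dbarFunctor n (n + 1)).map α.hom) := Iff.rfl

/-- Closure under isomorphism of arrows is what allows the class to be recovered as the image, under
an equivalence, of its inverse image. -/
instance : (sis t).RespectsIso := by
  have h {E F E' F' : ChDec t} {α : E ⟶ F} {α' : E' ⟶ F'} (a : E ≅ E') (b : F ≅ F')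
      (w : α ≫ b.hom = a.hom ≫ α') (n : ℤ) :=
    isQuasiIso_iff_of_iso
      (((Dec.compatible t).ι ⋙ Dec.dbarFunctor n (n + 1)).mapIso a)
      (((Dec.compatible t).ι ⋙ Dec.dbarFunctor n (n + 1)).mapIso b)
      (f := ((Dec.compatible t).ι ⋙ Dec.dbarFunctor n (n + 1)).map α)
      (f' := ((Dec.compatible t).ι ⋙ Dec.dbarFunctor n (n + 1)).map α')
      (by
        rw [Functor.mapIso_hom, Functor.mapIso_hom, ← Functor.map_comp, ← Functor.map_comp, w])
  refine MorphismProperty.RespectsIso.mk _ (fun e f hf n => ?_) (fun e f hf n => ?_)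
  · exact (h e (Iso.refl _) (Category.comp_id _) n).2 (hf n)
  · exact (h (α := f ≫ e.hom) (Iso.refl _) e.symm ((Category.assoc _ _ _).trans
      ((f ≫= e.hom_inv_id).trans ((Category.comp_id f).trans (Category.id_comp f).symm))) n).2 (hf n)

instance : (qis t).RespectsIso := by
  refine MorphismProperty.RespectsIso.mk _ (fun e f hf => ?_) (fun e f hf => ?_)
  · have : IsIso (((Dec.compatible t).ι ⋙ Dec.forget).map e.hom) := inferInstance
    have : IsIso (Dec.Hom.φ e.hom.hom) := this
    have : QuasiIso (Dec.Hom.φ f.hom) := hf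
    exact inferInstanceAs (QuasiIso (Dec.Hom.φ e.hom.hom ≫ Dec.Hom.φ f.hom))
  · have : IsIso (((Dec.compatible t).ι ⋙ Dec.forget).map e.hom) := inferInstance
    have : IsIso (Dec.Hom.φ e.hom.hom) := this
    have : QuasiIso (Dec.Hom.φ f.hom) := hf
    exact inferInstanceAs (QuasiIso (Dec.Hom.φ f.hom ≫ Dec.Hom.φ e.hom.hom))

end ChDec

namespace Tot

variable {t : TorsionPair A}

/-- The two-term complex `X n` is recovered from `Tot X`. -/
def dbarIso (X : ChSt t) (i : ℤ) :
    (Dec.dbarFunctor i (i + 1)).obj ((aux t).obj X) ≅ (X.cx.X (i + 1)).arrow :=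
  Arrow.isoMk (Subobject.underlyingIso (rep X i).ι) (quotIso (rep X (i + 1)))
    (dbar_auxObj X i).symm

lemma factorThru_underlyingIso {X Y X' Y' : Arrow A} {P : Butterfly X Y} {P' : Butterfly X' Y'}
    {g : P.E ⟶ P'.E} {l : Y.left ⟶ Y'.left} (hl : P.ι ≫ g = l ≫ P'.ι)
    (h : (Subobject.mk P'.ι).Factors ((Subobject.mk P.ι).arrow ≫ g)) :
    (Subobject.mk P'.ι).factorThru _ h ≫ (Subobject.underlyingIso P'.ι).hom =
      (Subobject.underlyingIso P.ι).hom ≫ l := by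
  rw [← cancel_mono P'.ι, Category.assoc, Category.assoc, ← hl,
    Subobject.underlyingIso_hom_comp_eq_mk, Subobject.underlyingIso_hom_comp_eq_mk_assoc,
    Subobject.factorThru_arrow]

lemma cokernelMap_quotIso {X Y X' Y' : Arrow A} {P : Butterfly X Y} {P' : Butterfly X' Y'}
    {g : P.E ⟶ P'.E} {r : X.right ⟶ X'.right} (hr : g ≫ P'.σ = P.σ ≫ r)
    (m : (Subobject.mk P.ι : A) ⟶ (Subobject.mk P'.ι : A))
    (hm : (Subobject.mk P.ι).arrow ≫ g = m ≫ (Subobject.mk P'.ι).arrow) :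
    cokernel.map _ _ m g hm ≫ (quotIso P').hom = (quotIso P).hom ≫ r := by
  rw [← cancel_epi (cokernel.π _)]
  simp [quotIso, hr]

lemma dbarIso_hom_naturality {X Y : ChSt t} (φ : X ⟶ Y) (i : ℤ) :
    (Dec.dbarFunctor i (i + 1)).map ((aux t).map φ) ≫ (dbarIso Y i).hom =
      (dbarIso X i).hom ≫ ChSt.Hom.f φ (i + 1) := by
  ext
  · exact factorThru_underlyingIso (ι_map φ i) (factors_map φ i)
  · exact cokernelMap_quotIso (map_σ φ (i + 1)) (Dec.mapM ((aux t).map φ) (i + 1))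
      (Dec.mapM_arrow ((aux t).map φ) (i + 1)).symm

/-- The equation between `i` and `j` is kept as a hypothesis because reindexing produces the pair (n
- 1, n + 1 - 1), where the second index is not syntactically the successor of the first. -/
lemma isQuasiIso_dbar_iff {X Y : ChSt t} (φ : X ⟶ Y) (i j : ℤ) (h : i + 1 = j) :
    IsQuasiIso ((Dec.dbarFunctor i j).map ((aux t).map φ)) ↔ IsQuasiIso (ChSt.Hom.f φ j) := by
  subst h
  exact isQuasiIso_iff_of_iso _ _ (dbarIso_hom_naturality φ i)

lemma sis_iff {X Y : ChSt t} (φ : X ⟶ Y) :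
    ChSt.sis t φ ↔ ∀ n, IsQuasiIso (ChSt.Hom.f φ n) := by
  simp only [← Tilt.isIso_strict_iff]
  constructor
  · intro h n
    have : IsIso ((ChSt.toCh t).map φ) := h
    exact inferInstanceAs (IsIso (((ChSt.toCh t).map φ).f n))
  · intro h
    have (n : ℤ) : IsIso (((ChSt.toCh t).map φ).f n) := h n
    exact HomologicalComplex.Hom.isIso_of_components ((ChSt.toCh t).map φ)

lemma sis_map_iff {X Y : ChSt t} (φ : X ⟶ Y) :
    ChDec.sis t ((Tot t).map φ) ↔ ChSt.sis t φ := by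
  rw [sis_iff, ChDec.sis_iff]
  have key (n : ℤ) : IsQuasiIso ((Dec.dbarFunctor n (n + 1)).map ((Tot t).map φ).hom) ↔
      IsQuasiIso (ChSt.Hom.f φ (n + 1 - 1)) :=
    isQuasiIso_dbar_iff φ (n - 1) (n + 1 - 1) (by omega)
  refine forall_congr' fun n => (key n).trans ?_
  rw [add_sub_cancel_right]

end Tot

/-! ### `Tot` is an equivalence -/

namespace Butterfly

variable {X Y Z W : Arrow A}

/-- A link between two consecutive butterflies. -/
structure IsLink (P : Butterfly X Y) (Q : Butterfly Y Z) (δ : P.E ⟶ Q.E) : Prop where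
  κ : P.κ ≫ δ = 0
  ι : P.ι ≫ δ = Q.κ
  σ : δ ≫ Q.σ = P.ρ
  ρ : δ ≫ Q.ρ = 0

/-- Links are compatible with isomorphisms of butterflies. -/
lemma IsLink.naturality {P P' : Butterfly X Y} {Q Q' : Butterfly Y Z} {δ : P.E ⟶ Q.E}
    {δ' : P'.E ⟶ Q'.E} (h : IsLink P Q δ) (h' : IsLink P' Q' δ') (t : TorsionPair A)
    (hX : t.T (cokernel X.hom)) (hZ : t.F (kernel Z.hom)) {e : P.E ⟶ P'.E} {f : Q.E ⟶ Q'.E}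
    (eκ : P.κ ≫ e = P'.κ) (eι : P.ι ≫ e = P'.ι) (eρ : e ≫ P'.ρ = P.ρ)
    (fκ : Q.κ ≫ f = Q'.κ) (fσ : f ≫ Q'.σ = Q.σ) (fρ : f ≫ Q'.ρ = Q.ρ) :
    e ≫ δ' = δ ≫ f := by
  rw [← sub_eq_zero]
  refine eq_zero_of_torsion t hX hZ _ ?_ ?_ ?_ ?_
  · rw [Preadditive.comp_sub, reassoc_of% eκ, reassoc_of% h.κ, h'.κ, zero_comp, sub_self]
  · rw [Preadditive.comp_sub, reassoc_of% eι, reassoc_of% h.ι, h'.ι, fκ, sub_self]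
  · rw [Preadditive.sub_comp, Category.assoc, Category.assoc, h'.σ, fσ, h.σ, eρ, sub_self]
  · rw [Preadditive.sub_comp, Category.assoc, Category.assoc, h'.ρ, fρ, h.ρ, comp_zero, sub_self]

/-- A link between two butterflies forces their composition to be zero. -/
lemma IsLink.comp_equiv_zero {P : Butterfly X Y} {Q : Butterfly Y Z} {δ : P.E ⟶ Q.E}
    (h : IsLink P Q δ) : comp P Q ≈ ofHom (zeroHom X Z) := by
  obtain ⟨hκ, hι, hσ, hρ⟩ := h
  have h0 : (pullback.snd P.ρ Q.σ - pullback.fst P.ρ Q.σ ≫ δ) ≫ Q.σ = 0 := by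
    rw [Preadditive.sub_comp, Category.assoc, hσ, pullback.condition, sub_self]
  -- For a pair (x, y) in the fibre product, y - δ(x) is killed by σ and so comes from Z⁻¹. Together
  -- with σ(x) this trivialises the composition.
  obtain ⟨s, hs⟩ : ∃ s, s ≫ Q.ι = pullback.snd P.ρ Q.σ - pullback.fst P.ρ Q.σ ≫ δ :=
    ⟨Q.exact.exact.lift _ h0, Q.exact.exact.lift_f _ h0⟩
  refine IsComp.equiv (r := biprod.lift (pullback.fst P.ρ Q.σ ≫ P.σ) s) ⟨?_, ?_, ?_, ?_, ?_⟩
  · apply biprod.hom_ext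
    · simp [reassoc_of% @compRel_fst, P.ι_σ]
    · rw [← cancel_mono Q.ι]
      simp [hs, compRel_snd, reassoc_of% @compRel_fst, hι]
  · apply biprod.hom_ext
    · simp [reassoc_of% @compκ_fst, P.κ_σ]
    · rw [← cancel_mono Q.ι]
      simp [hs, compκ_snd, reassoc_of% @compκ_fst, hκ, zeroHom]
  · apply biprod.hom_ext
    · simp [reassoc_of% @compι_fst]
    · rw [← cancel_mono Q.ι]
      simp [hs, compι_snd, reassoc_of% @compι_fst]
  · simp
  · have : s ≫ Z.hom = pullback.snd P.ρ Q.σ ≫ Q.ρ := by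
      rw [← Q.ι_ρ, reassoc_of% hs, Preadditive.sub_comp, Category.assoc, hρ, comp_zero, sub_zero]
    simp [zeroHom, biprod.lift_desc, this]

/-- A map of middle objects compatible with two strict morphisms gives a commutative square. -/
lemma comp_ofHom_equiv_ofHom_comp {P : Butterfly X Y} {g : Y ⟶ Z} {f : X ⟶ W} {Q : Butterfly W Z}
    (φ : P.E ⟶ Q.E) (hκ : P.κ ≫ φ = f.left ≫ Q.κ) (hι : P.ι ≫ φ = g.left ≫ Q.ι)
    (hσ : φ ≫ Q.σ = P.σ ≫ f.right) (hρ : φ ≫ Q.ρ = P.ρ ≫ g.right) :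
    comp P (ofHom g) ≈ comp (ofHom f) Q := by
  have hc := isComp_comp (ofHom f) Q
  obtain ⟨m, hm1, hm2⟩ : ∃ m : P.E ⟶ pullback (ofHom f).ρ Q.σ,
      m ≫ pullback.fst _ _ = biprod.lift P.σ 0 ∧ m ≫ pullback.snd _ _ = φ :=
    ⟨pullback.lift (biprod.lift P.σ 0) φ (by simp [hσ]), pullback.lift_fst _ _ _,
      pullback.lift_snd _ _ _⟩
  refine comp_ofHom_equiv (m ≫ compπ (ofHom f) Q) ?_ ?_ ?_ ?_
  · have : P.κ ≫ m = compκ (ofHom f) Q + f.left ≫ compRel (ofHom f) Q := by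
      apply pullback.hom_ext
      · rw [Category.assoc, hm1, Preadditive.add_comp, compκ_fst, Category.assoc, compRel_fst]
        apply biprod.hom_ext <;> simp [P.κ_σ]
      · rw [Category.assoc, hm2, Preadditive.add_comp, compκ_snd, Category.assoc, compRel_snd,
          hκ, zero_add]
    rw [reassoc_of% this, Preadditive.add_comp, Category.assoc, hc.rel, hc.κ, comp_zero, add_zero]
  · have : P.ι ≫ m = g.left ≫ compι (ofHom f) Q := by
      apply pullback.hom_ext
      · rw [Category.assoc, hm1, Category.assoc, compι_fst]
        apply biprod.hom_ext <;> simp [P.ι_σ]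
      · rw [Category.assoc, hm2, Category.assoc, compι_snd, hι]
    rw [reassoc_of% this, hc.ι]
  · rw [Category.assoc, hc.σ, reassoc_of% hm1]
    simp
  · rw [Category.assoc, hc.ρ, reassoc_of% hm2, hρ]

end Butterfly

namespace Dec

/-- Isomorphisms of decorated complexes. -/
def isoMk {E F : Dec A} (e : E.cx ≅ F.cx)
    (h : ∀ n, (F.M n).Factors ((E.M n).arrow ≫ e.hom.f n))
    (h' : ∀ n, (E.M n).Factors ((F.M n).arrow ≫ e.inv.f n)) : E ≅ F where
  hom := { φ := e.hom, factors := h }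
  inv := { φ := e.inv, factors := h' }
  hom_inv_id := Hom.ext e.hom_inv_id
  inv_hom_id := Hom.ext e.inv_hom_id

/-- The inverse of `Dec.reindex` on objects. -/
def unindex (E : Dec A) : Dec A where
  cx :=
    { X := fun n => E.cx.X (n + 1)
      d := fun i j => E.cx.d (i + 1) (j + 1)
      shape := fun i j hij => E.cx.shape _ _ fun h => hij (by
        simp only [ComplexShape.up_Rel] at h ⊢
        omega)
      d_comp_d' := fun _ _ _ _ _ => E.cx.d_comp_d _ _ _ }
  M := fun n => E.M (n + 1)

lemma factors_XIsoOfEq (E : Dec A) {i j : ℤ} (h : i = j) :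
    (E.M j).Factors ((E.M i).arrow ≫ (E.cx.XIsoOfEq h).hom) := by
  subst h
  rw [HomologicalComplex.XIsoOfEq_rfl, Iso.refl_hom, Category.comp_id]
  exact (E.M i).factors_self

/-- `Dec.unindex` is right inverse to `Dec.reindex`. -/
def reindexUnindex (E : Dec A) : reindex.obj E.unindex ≅ E :=
  isoMk (HomologicalComplex.Hom.isoOfComponents
      (fun n => E.cx.XIsoOfEq (show n - 1 + 1 = n by simp)) (fun i j _ => by
        change (E.cx.XIsoOfEq _).hom ≫ E.cx.d i j =
          E.cx.d (i - 1 + 1) (j - 1 + 1) ≫ (E.cx.XIsoOfEq _).hom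
        rw [HomologicalComplex.XIsoOfEq_hom_comp_d, HomologicalComplex.d_comp_XIsoOfEq_hom]))
    (fun n => E.factors_XIsoOfEq (sub_add_cancel n 1))
    (fun n => E.factors_XIsoOfEq (sub_add_cancel n 1).symm)

/-- The butterfly with middle object `E j` of a decorated complex. -/
def butterfly (E : Dec A) (i j k : ℤ) :
    Butterfly (Arrow.mk (E.dbar i j)) (Arrow.mk (E.dbar j k)) where
  E := E.cx.X j
  κ := (E.M i).arrow ≫ E.cx.d i j
  ι := (E.M j).arrow
  σ := cokernel.π (E.M j).arrow
  ρ := E.cx.d j k ≫ cokernel.π (E.M k).arrow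
  κ_σ := by simp [dbar]
  ι_ρ := by simp [dbar]
  κ_ρ := by simp
  ι_σ := cokernel.condition _
  exact := { exact := ShortComplex.exact_cokernel _ }

/-- The second diagonals were defined through the differential, so two of the link conditions hold
by definition, and the other two are d ∘ d = 0. -/
lemma isLink_d (E : Dec A) (i j k l : ℤ) :
    (E.butterfly i j k).IsLink (E.butterfly j k l) (E.cx.d j k) where
  κ := by
    change ((E.M i).arrow ≫ E.cx.d i j) ≫ E.cx.d j k = 0
    simp
  ι := rfl
  σ := rfl
  ρ := by
    change E.cx.d j k ≫ E.cx.d k l ≫ _ = 0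
    simp

end Dec

/-! ### Full faithfulness and essential surjectivity -/

namespace Tot

variable {t : TorsionPair A}

/-- The left components are determined because ι is mono, the right ones because σ is epi. -/
instance : (Tot t).Faithful where
  map_injective {X Y} φ ψ h := by
    have h' (n : ℤ) : map φ n = map ψ n := by
      -- Degree n + 1 of `Tot` is degree n + 1 - 1 of the unshifted complex.
      have : map φ (n + 1 - 1) = map ψ (n + 1 - 1) :=
        congrArg (fun α => (Dec.Hom.φ (InducedCategory.Hom.hom α)).f (n + 1)) h
      rwa [add_sub_cancel_right] at this
    refine ChSt.Hom.ext (funext fun n => ?_)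
    ext
    · obtain ⟨n, rfl⟩ : ∃ m, n = m + 1 := ⟨n - 1, by simp⟩
      rw [← cancel_mono (rep Y n).ι, ← ι_map, ← ι_map, h']
    · rw [← cancel_epi (rep X n).σ, ← map_σ, ← map_σ, h']

/-- Preserving the decoration gives maps on sources of ι and on targets of σ. Since κ is ι followed
by the link, and ρ is the link followed by σ, commutation with the links yields the remaining two
compatibilities, hence a commutative square in B. -/
lemma exists_hom_of_map {X Y : ChSt t} (g : ∀ n, (rep X n).E ⟶ (rep Y n).E)
    (comm : ∀ n, g n ≫ δ Y n = δ X n ≫ g (n + 1))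
    (factors : ∀ n, (Subobject.mk (rep Y n).ι).Factors ((Subobject.mk (rep X n).ι).arrow ≫ g n)) :
    ∃ φ : X ⟶ Y, ∀ n, map φ n = g n := by
  have hl (n : ℤ) : ∃ l, (rep X n).ι ≫ g n = l ≫ (rep Y n).ι := by
    obtain ⟨l, hl⟩ : ∃ l : (Subobject.mk (rep X n).ι : A) ⟶ (Y.cx.X (n + 1)).arrow.left,
        l ≫ (rep Y n).ι = (Subobject.mk (rep X n).ι).arrow ≫ g n :=
      (Subobject.mk_factors_iff _ _).1 (factors n)
    refine ⟨(Subobject.underlyingIso (rep X n).ι).inv ≫ l, ?_⟩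
    rw [Category.assoc, hl, Subobject.underlyingIso_arrow_assoc]
  choose l hl using hl
  have hr (n : ℤ) : ∃ r, g n ≫ (rep Y n).σ = (rep X n).σ ≫ r := by
    have h0 : (rep X n).ι ≫ g n ≫ (rep Y n).σ = 0 := by
      rw [reassoc_of% hl, (rep Y n).ι_σ, comp_zero]
    exact ⟨(rep X n).exact.exact.desc _ h0, ((rep X n).exact.exact.g_desc _ h0).symm⟩
  choose r hr using hr
  have hκ (n : ℤ) : (rep X (n + 1)).κ ≫ g (n + 1) = l n ≫ (rep Y (n + 1)).κ := by
    rw [← ι_δ, Category.assoc, ← comm, reassoc_of% hl, ι_δ]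
  have hρ (n : ℤ) : g n ≫ (rep Y n).ρ = (rep X n).ρ ≫ r (n + 1) := by
    rw [← δ_σ, reassoc_of% comm, hr, reassoc_of% δ_σ]
  -- The middle object in degree n determines the left component in degree n + 1 and the right
  -- component in degree n. The family is thus known at indices n + 1 and is transported along the
  -- bijection n ↦ n + 1.
  obtain ⟨f, hf⟩ : ∃ f : ∀ n, (X.cx.X n).arrow ⟶ (Y.cx.X n).arrow, ∀ n,
      (f (n + 1)).left = l n ∧ (f (n + 1)).right = r (n + 1) := by
    let a (n : ℤ) : (X.cx.X (n + 1)).arrow ⟶ (Y.cx.X (n + 1)).arrow :=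
      Arrow.homMk (l n) (r (n + 1)) (by
        rw [← (rep X n).ι_ρ, Category.assoc, ← hρ, reassoc_of% hl, (rep Y n).ι_ρ])
    let P (n : ℤ) := ((X.cx.X n).arrow ⟶ (Y.cx.X n).arrow)
    refine ⟨(Equiv.addRight (1 : ℤ)).piCongrLeft P a, fun n => ?_⟩
    have : (Equiv.addRight (1 : ℤ)).piCongrLeft P a (n + 1) = a n :=
      Equiv.piCongrLeft_apply_apply P (Equiv.addRight (1 : ℤ)) a n
    rw [this]
    exact ⟨rfl, rfl⟩
  have hκ' (n : ℤ) : (rep X n).κ ≫ g n = (f n).left ≫ (rep Y n).κ := by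
    obtain ⟨n, rfl⟩ : ∃ m, n = m + 1 := ⟨n - 1, by simp⟩
    rw [(hf n).1, hκ]
  have hι' (n : ℤ) : (rep X n).ι ≫ g n = (f (n + 1)).left ≫ (rep Y n).ι := by
    rw [(hf n).1, hl]
  have hσ' (n : ℤ) : g n ≫ (rep Y n).σ = (rep X n).σ ≫ (f n).right := by
    obtain ⟨n, rfl⟩ : ∃ m, n = m + 1 := ⟨n - 1, by simp⟩
    rw [(hf n).2, hr]
  have hρ' (n : ℤ) : g n ≫ (rep Y n).ρ = (rep X n).ρ ≫ (f (n + 1)).right := by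
    rw [(hf n).2, hρ]
  refine ⟨⟨f, fun i j => ?_⟩, fun n => map_ext n ?_ ?_ ?_ ?_⟩
  · by_cases h : i + 1 = j
    · subst h
      have := (Tilt.ofB_eq_iff (X := X.cx.X i) (Y := Y.cx.X (i + 1)) _ _).2
        (Butterfly.comp_ofHom_equiv_ofHom_comp (g i) (hκ' i) (hι' i) (hσ' i) (hρ' i))
      rw [← Tilt.ofB_comp, ← Tilt.ofB_comp, rep, rep, Tilt.ofB_out, Tilt.ofB_out] at this
      exact this.symm
    · rw [X.cx.shape i j h, Y.cx.shape i j h, comp_zero, zero_comp]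
  · rw [κ_map, hκ']
  · rw [ι_map, hι']
  · rw [map_σ, hσ']
  · rw [map_ρ, hρ']

instance : (Tot t).Full where
  map_surjective {X Y} α := by
    let P (n : ℤ) := (rep X n).E ⟶ (rep Y n).E
    let a (n : ℤ) : P (n - 1) := (Dec.Hom.φ α.hom).f n
    obtain ⟨g, hg⟩ : ∃ g : ∀ n, P n, ∀ n, g (n - 1) = a n :=
      ⟨(Equiv.subRight (1 : ℤ)).piCongrLeft P a,
        Equiv.piCongrLeft_apply_apply P (Equiv.subRight (1 : ℤ)) a⟩
    obtain ⟨φ, hφ⟩ := exists_hom_of_map g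
      (fun n => by
        -- Two free indices allow both to be rewritten as m - 1, the only form in which `g` is
        -- known.
        have key (i j : ℤ) (h : i + 1 = j) : g i ≫ (auxObj Y).cx.d i j =
            (auxObj X).cx.d i j ≫ g j := by
          obtain ⟨i, rfl⟩ : ∃ m, i = m - 1 := ⟨i + 1, by simp⟩
          obtain ⟨j, rfl⟩ : ∃ m, j = m - 1 := ⟨j + 1, by simp⟩
          rw [hg, hg]
          exact (Dec.Hom.φ α.hom).comm i j
        have := key n (n + 1) rfl
        rwa [auxObj_d, auxObj_d] at this)
      (fun n => by
        obtain ⟨n, rfl⟩ : ∃ m, n = m - 1 := ⟨n + 1, by simp⟩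
        rw [hg]
        exact Dec.Hom.factors α.hom n)
    refine ⟨φ, ?_⟩
    apply InducedCategory.Hom.ext
    refine Dec.Hom.ext ?_
    ext n
    exact (hφ (n - 1)).trans (hg n)

/-- The complex in `B` of a decorated complex. -/
def ofDec (E : ChDec t) : ChSt t where
  cx := CochainComplex.of
    (fun n => { arrow := Arrow.mk (E.obj.dbar n (n + 1))
                ker_mem := (E.property n).1
                coker_mem := (E.property n).2 })
    (fun n => Tilt.ofB (E.obj.butterfly n (n + 1) (n + 1 + 1)))
    (fun n => by
      rw [Tilt.ofB_comp, Tilt.zero_def, Tilt.ofB_eq_iff]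
      exact (E.obj.isLink_d n (n + 1) (n + 1 + 1) (n + 1 + 1 + 1)).comp_equiv_zero)

/-- The representative chosen by `rep` is arbitrary, so it agrees with the butterfly of E only up to
isomorphism. -/
lemma rep_ofDec (E : ChDec t) (n : ℤ) :
    rep (ofDec E) n ≈ E.obj.butterfly n (n + 1) (n + 1 + 1) := by
  refine (Tilt.ofB_eq_iff (X := (ofDec E).cx.X n) (Y := (ofDec E).cx.X (n + 1)) _ _).1 ?_
  rw [rep, Tilt.ofB_out]
  exact CochainComplex.of_d (fun n => (⟨Arrow.mk (E.obj.dbar n (n + 1)), (E.property n).1,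
    (E.property n).2⟩ : Tilt t)) (fun n => Tilt.ofB (E.obj.butterfly n (n + 1) (n + 1 + 1))) n

lemma isLink_δ (X : ChSt t) (n : ℤ) : (rep X n).IsLink (rep X (n + 1)) (δ X n) :=
  ⟨κ_δ X n, ι_δ X n, δ_σ X n, δ_ρ X n⟩

lemma factors_of_ι_comp_eq {X Y : Arrow A} {P : Butterfly X Y} {E : A} {N : Subobject E}
    {f : P.E ⟶ E} {l : Y.left ⟶ (N : A)} (h : P.ι ≫ f = l ≫ N.arrow) :
    N.Factors ((Subobject.mk P.ι).arrow ≫ f) := by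
  rw [← Subobject.underlyingIso_hom_comp_eq_mk, Category.assoc, h, ← Category.assoc]
  exact Subobject.factors_comp_arrow _

lemma factors_of_eq_ι {X Y : Arrow A} {P : Butterfly X Y} {f : Y.left ⟶ P.E} (h : f = P.ι) :
    (Subobject.mk P.ι).Factors f := by
  rw [h]
  exact Subobject.mk_factors_self P.ι

/-- The isomorphisms from chosen to constructed butterflies respect ι, hence the decorations. They
commute with the differentials because links are unique. -/
lemma nonempty_iso_unindex (E : ChDec t) : Nonempty ((aux t).obj (ofDec E) ≅ E.obj.unindex) := by
  choose e h1 h2 h3 h4 using rep_ofDec E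
  -- The isomorphisms `e n` were chosen independently. The vanishing of morphisms from 𝒯 to ℱ makes
  -- them commute with the links.
  have hδ (n : ℤ) : (e n).hom ≫ E.obj.cx.d (n + 1) (n + 1 + 1) =
      δ (ofDec E) n ≫ (e (n + 1)).hom :=
    (isLink_δ (ofDec E) n).naturality (P' := E.obj.butterfly n (n + 1) (n + 1 + 1))
      (Q' := E.obj.butterfly (n + 1) (n + 1 + 1) (n + 1 + 1 + 1)) (E.obj.isLink_d _ _ _ _) t
      ((ofDec E).cx.X n).coker_mem ((ofDec E).cx.X (n + 1 + 1)).ker_mem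
      (h1 n) (h2 n) (h4 n) (h1 (n + 1)) (h3 (n + 1)) (h4 (n + 1))
  refine ⟨Dec.isoMk (HomologicalComplex.Hom.isoOfComponents e ?_) ?_ ?_⟩
  · rintro i _ rfl
    exact (hδ i).trans (congrArg (· ≫ _) (auxObj_d (ofDec E) i).symm)
  · intro n
    exact factors_of_ι_comp_eq (N := E.obj.M (n + 1)) (P := rep (ofDec E) n) (l := 𝟙 _)
      ((h2 n).trans (Category.id_comp _).symm)
  · intro n
    exact factors_of_eq_ι (P := rep (ofDec E) n) ((Iso.comp_inv_eq _).2 (h2 n).symm)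

instance : (Tot t).EssSurj where
  mem_essImage E := by
    obtain ⟨e⟩ := nonempty_iso_unindex E
    exact ⟨ofDec E, ⟨(Dec.compatible t).isoMk (Dec.reindex.mapIso e ≪≫ E.obj.reindexUnindex)⟩⟩

instance : (Tot t).IsEquivalence where

end Tot

end HRSTilt

end

/-! ### The equivalence and the correspondence of the two classes of morphisms -/

theorem theoremT {A : Type u} [CategoryTheory.Category.{v} A] [CategoryTheory.Abelian A]
    (t : HRSTilt.TorsionPair A) :
    (HRSTilt.Tot t).IsEquivalence ∧
      ((HRSTilt.ChSt.sis t).map (HRSTilt.Tot t) = HRSTilt.ChDec.sis t ∧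
        (HRSTilt.ChDec.sis t).inverseImage (HRSTilt.Tot t) = HRSTilt.ChSt.sis t) ∧
      ((HRSTilt.ChSt.qis t).map (HRSTilt.Tot t) = HRSTilt.ChDec.qis t ∧
        (HRSTilt.ChDec.qis t).inverseImage (HRSTilt.Tot t) = HRSTilt.ChSt.qis t) := by
  have h₁ : (HRSTilt.ChDec.sis t).inverseImage (HRSTilt.Tot t) = HRSTilt.ChSt.sis t := by
    ext X Y φ
    exact HRSTilt.Tot.sis_map_iff φ
  have h₂ : (HRSTilt.ChDec.qis t).inverseImage (HRSTilt.Tot t) = HRSTilt.ChSt.qis t := by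
    ext X Y φ
    exact HRSTilt.Tot.qis_map_iff φ
  refine ⟨inferInstance, ⟨?_, h₁⟩, ⟨?_, h₂⟩⟩
  -- For an equivalence and a class closed under isomorphism of arrows, the image of the inverse
  -- image is the whole class.
  · rw [← h₁, MorphismProperty.map_inverseImage_eq_of_isEquivalence]
  · rw [← h₂, MorphismProperty.map_inverseImage_eq_of_isEquivalence]
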